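/- An inverse semigroup is regarded as an algebra with a binary multiplication and a unary inversion satisfying $(xy)z=x(yz)$, $(xy)^{-1}=y^{-1}x^{-1}$, $(x^{-1})^{-1}=x$, $xx^{-1}x=x$ and $x^{-1}xy^{-1}y=y^{-1}yx^{-1}x$. Let $F$ be the free inverse semigroup over a finite set $X$, and let $\mathrm{End}(F)$ be the semigroup of all endomorphisms of $F$ under composition. Theorem. Every automorphism of $\mathrm{End}(F)$ is inner: for every automorphism $\Phi$ of the semigroup $\mathrm{End}(F)$ there is an automorphism $\sigma$ of $F$ such that $\Phi(\nu)=\sigma\circ\nu\circ\sigma^{-1}$ for every $\nu\in\mathrm{End}(F)$. -/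

import Mathlib

universe u v

/-- Inverse semigroups, as algebras with a binary multiplication and a unary inversion, defined by
the identities `(xy)z = x(yz)`, `(xy)⁻¹ = y⁻¹x⁻¹`, `(x⁻¹)⁻¹ = x`, `xx⁻¹x = x` and
`x⁻¹xy⁻¹y = y⁻¹yx⁻¹x`. -/
class InverseSemigroup (S : Type u) extends Semigroup S, Inv S where
  protected mul_inv_rev (a b : S) : (a * b)⁻¹ = b⁻¹ * a⁻¹
  protected inv_inv (a : S) : (a⁻¹)⁻¹ = a
  protected mul_inv_mul (a : S) : a * a⁻¹ * a = a
  protected inv_mul_comm (a b : S) : a⁻¹ * a * (b⁻¹ * b) = b⁻¹ * b * (a⁻¹ * a)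

namespace InverseSemigroup

/-- Homomorphisms of inverse semigroups: maps that preserve multiplication and inversion. -/
@[ext]
structure Hom (S : Type u) (T : Type v) [InverseSemigroup S] [InverseSemigroup T] where
  toFun : S → T
  map_mul' (a b : S) : toFun (a * b) = toFun a * toFun b
  map_inv' (a : S) : toFun a⁻¹ = (toFun a)⁻¹

instance (S : Type u) (T : Type v) [InverseSemigroup S] [InverseSemigroup T] :
    FunLike (Hom S T) S T where
  coe := Hom.toFun
  coe_injective _ _ h := Hom.ext h

/-- The endomorphisms of an inverse semigroup. -/
abbrev End (S : Type u) [InverseSemigroup S] : Type u := Hom S S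

/-- `End S` under composition: `(ν * μ) a = ν (μ a)`. -/
instance (S : Type u) [InverseSemigroup S] : Monoid (End S) where
  mul ν μ :=
    { toFun := fun a => ν.toFun (μ.toFun a)
      map_mul' := fun a b => by rw [μ.map_mul', ν.map_mul']
      map_inv' := fun a => by rw [μ.map_inv', ν.map_inv'] }
  one := { toFun := id, map_mul' := fun _ _ => rfl, map_inv' := fun _ => rfl }
  mul_assoc _ _ _ := rfl
  one_mul _ := rfl
  mul_one _ := rfl

/-- An automorphism `Φ` of the semigroup `End S` is inner if there is an automorphism `σ` of `S`
such that `Φ ν = σ ∘ ν ∘ σ⁻¹` for every endomorphism `ν` of `S`. -/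
def IsInner {S : Type u} [InverseSemigroup S] (Φ : End S ≃* End S) : Prop :=
  ∃ σ : S ≃* S, (∀ a : S, σ a⁻¹ = (σ a)⁻¹) ∧ ∀ (ν : End S) (a : S), (Φ ν) a = σ (ν (σ.symm a))

end InverseSemigroup

/-- Terms over `X` in one binary operation (multiplication) and one unary operation (inversion). -/
inductive InvTerm (X : Type u) : Type u
  | of : X → InvTerm X
  | mul : InvTerm X → InvTerm X → InvTerm X
  | inv : InvTerm X → InvTerm X

namespace InvTerm

/-- The least congruence on terms that contains all instances of the defining identities of
inverse semigroups. -/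
inductive Rel {X : Type u} : InvTerm X → InvTerm X → Prop
  | refl (a) : Rel a a
  | symm {a b} : Rel a b → Rel b a
  | trans {a b c} : Rel a b → Rel b c → Rel a c
  | mul {a b c d} : Rel a b → Rel c d → Rel (mul a c) (mul b d)
  | inv {a b} : Rel a b → Rel (inv a) (inv b)
  | assoc (a b c) : Rel (mul (mul a b) c) (mul a (mul b c))
  | mul_inv_rev (a b) : Rel (inv (mul a b)) (mul (inv b) (inv a))
  | inv_inv (a) : Rel (inv (inv a)) a
  | mul_inv_mul (a) : Rel (mul (mul a (inv a)) a) a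
  | inv_mul_comm (a b) :
      Rel (mul (mul (inv a) a) (mul (inv b) b)) (mul (mul (inv b) b) (mul (inv a) a))

instance setoid (X : Type u) : Setoid (InvTerm X) where
  r := Rel
  iseqv := ⟨Rel.refl, Rel.symm, Rel.trans⟩

/-- The value of a term in an inverse semigroup under an assignment of the letters. -/
def eval {X : Type u} {S : Type v} [InverseSemigroup S] (f : X → S) : InvTerm X → S
  | of x => f x
  | mul a b => eval f a * eval f b
  | inv a => (eval f a)⁻¹

theorem Rel.eval_eq {X : Type u} {S : Type v} [InverseSemigroup S] (f : X → S)
    {a b : InvTerm X} (h : Rel a b) : eval f a = eval f b := by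
  induction h with
  | refl => rfl
  | symm _ ih => exact ih.symm
  | trans _ _ ih₁ ih₂ => exact ih₁.trans ih₂
  | mul _ _ ih₁ ih₂ => simp only [eval, ih₁, ih₂]
  | inv _ ih => simp only [eval, ih]
  | assoc => exact mul_assoc _ _ _
  | mul_inv_rev => exact InverseSemigroup.mul_inv_rev _ _
  | inv_inv => exact InverseSemigroup.inv_inv _
  | mul_inv_mul => exact InverseSemigroup.mul_inv_mul _
  | inv_mul_comm => exact InverseSemigroup.inv_mul_comm _ _

end InvTerm

/-- The free inverse semigroup on `X`: terms modulo the identities of inverse semigroups. -/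
def FreeInverseSemigroup (X : Type u) : Type u := Quotient (InvTerm.setoid X)

namespace FreeInverseSemigroup

instance (X : Type u) : InverseSemigroup (FreeInverseSemigroup X) where
  mul := Quotient.map₂ InvTerm.mul fun _ _ h _ _ h' => InvTerm.Rel.mul h h'
  inv := Quotient.map InvTerm.inv fun _ _ h => InvTerm.Rel.inv h
  mul_assoc := by rintro ⟨a⟩ ⟨b⟩ ⟨c⟩; exact Quotient.sound (InvTerm.Rel.assoc a b c)
  mul_inv_rev := by rintro ⟨a⟩ ⟨b⟩; exact Quotient.sound (InvTerm.Rel.mul_inv_rev a b)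
  inv_inv := by rintro ⟨a⟩; exact Quotient.sound (InvTerm.Rel.inv_inv a)
  mul_inv_mul := by rintro ⟨a⟩; exact Quotient.sound (InvTerm.Rel.mul_inv_mul a)
  inv_mul_comm := by rintro ⟨a⟩ ⟨b⟩; exact Quotient.sound (InvTerm.Rel.inv_mul_comm a b)

/-- The free generators. -/
def of {X : Type u} (x : X) : FreeInverseSemigroup X := Quotient.mk _ (InvTerm.of x)

/-- The universal property, which shows that `FreeInverseSemigroup X` is free over `X`. -/
theorem existsUnique_hom {X : Type u} {S : Type v} [InverseSemigroup S] (f : X → S) :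
    ∃! φ : InverseSemigroup.Hom (FreeInverseSemigroup X) S, ∀ x : X, φ (of x) = f x := by
  refine ⟨⟨Quotient.lift (InvTerm.eval f) fun _ _ h => InvTerm.Rel.eval_eq f h, ?_, ?_⟩, ?_, ?_⟩
  · rintro ⟨a⟩ ⟨b⟩; rfl
  · rintro ⟨a⟩; rfl
  · intro x; rfl
  · intro ψ hψ
    refine InverseSemigroup.Hom.ext (funext ?_)
    rintro ⟨a⟩
    induction a with
    | of x => exact hψ x
    | mul a b iha ihb =>
      exact (ψ.map_mul' (Quotient.mk _ a) (Quotient.mk _ b)).trans (congrArg₂ (· * ·) iha ihb)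
    | inv a iha => exact (ψ.map_inv' (Quotient.mk _ a)).trans (congrArg (·⁻¹) iha)

end FreeInverseSemigroup

/-! Composing any ν with `collapse a`, which sends all generators to a, gives `collapse (ν a)`. For
an idempotent e, `collapse e` is constant and so a left zero of End(F). Automorphisms preserve left
zeros, and evaluating Φ (`collapse a`) at a generator therefore defines a map `act` that permutes
the idempotents and satisfies `act (ν a) = Φ ν (act a)`. This equivariance is to be combined with
Munn's theorem (`munn_injective`): an element of F amounts to a finite subset of the free group with
a marked point. The free group is torsion-free, so no nontrivial translation preserves such a
subset, and a is determined by aa⁻¹ and a⁻¹a (`eq_of_mul_inv_of_inv_mul`).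

With two distinct generators, `act` is an automorphism of the semilattice of idempotents
(`act_mul`). It permutes the maximal idempotents zz⁻¹, z a letter (`exists_act_edge`), compatibly
with z ↦ z⁻¹ (`act_edge_bar`). The resulting permutation of letters extends to an automorphism of F,
and conjugating by it reduces to the case where `act` fixes every zz⁻¹. Then `act` also fixes a
product xy of two generators, so by equivariance it is multiplicative, hence the identity
(`act_eq_self`), and Φ is trivial.

With one generator, Munn trees are integer intervals and End(F) is a monoid of integer triples under
`Span.comp`. Its units are 1 and a reflection U, which Φ must fix. The two shifts A and B = UAU
extend an interval by one step on the left or on the right; Φ fixes A or sends it to B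
(`map_shift`), and conjugation by U reduces to the first case. There Φ fixes all constant
endomorphisms, and these separate the rest (`map_eq_self_of_shift`). -/

namespace InverseSemigroup

/-! ### Idempotents and their natural order. -/

section Basic

variable {S : Type u} [InverseSemigroup S]

/-- Idempotents, described as the elements `e` with `ee⁻¹ = e`. -/
def IsIdem (e : S) : Prop := e * e⁻¹ = e

theorem inv_mul_inv (a : S) : a⁻¹ * a * a⁻¹ = a⁻¹ := by
  have h := InverseSemigroup.mul_inv_mul a⁻¹
  rwa [InverseSemigroup.inv_inv] at h

theorem mul_inv_mul' (a b : S) : a * (a⁻¹ * (a * b)) = a * b := by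
  rw [← mul_assoc, ← mul_assoc, InverseSemigroup.mul_inv_mul]

theorem inv_mul_inv' (a b : S) : a⁻¹ * (a * (a⁻¹ * b)) = a⁻¹ * b := by
  rw [← mul_assoc, ← mul_assoc, inv_mul_inv]

theorem isIdem_mul_inv (a : S) : IsIdem (a * a⁻¹) := by
  unfold IsIdem
  rw [InverseSemigroup.mul_inv_rev, InverseSemigroup.inv_inv, ← mul_assoc,
    InverseSemigroup.mul_inv_mul]

theorem isIdem_inv_mul (a : S) : IsIdem (a⁻¹ * a) := by
  have h := isIdem_mul_inv a⁻¹
  rwa [InverseSemigroup.inv_inv] at h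

theorem IsIdem.inv_eq {e : S} (h : IsIdem e) : e⁻¹ = e := by
  have h' : (e * e⁻¹)⁻¹ = e⁻¹ := by rw [h]
  rw [InverseSemigroup.mul_inv_rev, InverseSemigroup.inv_inv, h] at h'
  exact h'.symm

theorem IsIdem.mul_self {e : S} (h : IsIdem e) : e * e = e := by
  have h' : e * e⁻¹ = e := h
  rwa [h.inv_eq] at h'

theorem IsIdem.mul_self_left {e : S} (h : IsIdem e) (a : S) : e * (e * a) = e * a := by
  rw [← mul_assoc, h.mul_self]

theorem IsIdem.comm {e f : S} (he : IsIdem e) (hf : IsIdem f) : e * f = f * e := by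
  have h := InverseSemigroup.inv_mul_comm e f
  rwa [he.inv_eq, hf.inv_eq, he.mul_self, hf.mul_self] at h

theorem IsIdem.left_comm {e f : S} (he : IsIdem e) (hf : IsIdem f) (a : S) :
    e * (f * a) = f * (e * a) := by
  rw [← mul_assoc, he.comm hf, mul_assoc]

theorem IsIdem.mul {e f : S} (he : IsIdem e) (hf : IsIdem f) : IsIdem (e * f) := by
  unfold IsIdem
  rw [InverseSemigroup.mul_inv_rev, he.inv_eq, hf.inv_eq, mul_assoc, hf.mul_self_left,
    hf.comm he, he.mul_self_left]

/-- The order of the semilattice of idempotents. -/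
def Below (e f : S) : Prop := e * f = e

theorem Below.trans {e f g : S} (h₁ : Below e f) (h₂ : Below f g) : Below e g := by
  unfold Below at *
  rw [← h₁, mul_assoc, h₂]

theorem Below.antisymm {e f : S} (he : IsIdem e) (hf : IsIdem f) (h₁ : Below e f)
    (h₂ : Below f e) : e = f := by
  unfold Below at *
  rw [← h₁, he.comm hf, h₂]

theorem IsIdem.below_self {e : S} (h : IsIdem e) : Below e e := h.mul_self

theorem below_mul_left (a b : S) : Below (a * b * (a * b)⁻¹) (a * a⁻¹) := by
  unfold Below
  rw [(isIdem_mul_inv (a * b)).comm (isIdem_mul_inv a)]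
  simp only [mul_assoc, mul_inv_mul']

theorem Below.mul_right {e f g : S} (he : Below e g) (hf : IsIdem f) (hg : IsIdem g) :
    Below (e * f) g := by
  unfold Below at *
  rw [mul_assoc, hf.comm hg, ← mul_assoc, he]

end Basic

/-! ### Homomorphisms, and conjugation of automorphisms of End(S). -/

section Homs

variable {S : Type u} {T : Type v} [InverseSemigroup S] [InverseSemigroup T]

theorem hom_mul (ν : Hom S T) (a b : S) : ν (a * b) = ν a * ν b := ν.map_mul' a b

theorem hom_inv (ν : Hom S T) (a : S) : ν a⁻¹ = (ν a)⁻¹ := ν.map_inv' a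

theorem hom_ext {ν μ : Hom S T} (h : ∀ a, ν a = μ a) : ν = μ := Hom.ext (funext h)

theorem IsIdem.map {e : S} (h : IsIdem e) (ν : Hom S T) : IsIdem (ν e) := by
  unfold IsIdem at *
  rw [← hom_inv, ← hom_mul, h]

theorem Below.map {e f : S} (h : Below e f) (ν : Hom S T) : Below (ν e) (ν f) := by
  unfold Below at *
  rw [← hom_mul, h]

theorem end_mul_apply (ν μ : End S) (a : S) : (ν * μ) a = ν (μ a) := rfl

theorem end_one_apply (a : S) : (1 : End S) a = a := rfl

theorem isInner_of_conj {Φ : End S ≃* End S} (σ σ' : End S) (h : σ * σ' = 1) (h' : σ' * σ = 1)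
    (hΦ : ∀ ν, Φ ν = σ * ν * σ') : IsInner Φ := by
  refine ⟨⟨⟨σ, σ', fun a => ?_, fun a => ?_⟩, hom_mul σ⟩, hom_inv σ, fun ν a => ?_⟩
  · rw [← end_mul_apply, h', end_one_apply]
  · rw [← end_mul_apply, h, end_one_apply]
  · rw [hΦ]; rfl

/-- Conjugation of an automorphism of `End S` with an automorphism of `S`. -/
def conj (Φ : End S ≃* End S) (σ σ' : End S) (h : σ * σ' = 1) (h' : σ' * σ = 1) :
    End S ≃* End S :=
  Φ.trans
    { toFun := fun ν => σ' * ν * σ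
      invFun := fun ν => σ * ν * σ'
      left_inv := fun ν => by
        simp only [mul_assoc, h, mul_one]
        rw [← mul_assoc, h, one_mul]
      right_inv := fun ν => by
        simp only [mul_assoc, h', mul_one]
        rw [← mul_assoc, h', one_mul]
      map_mul' := fun ν μ => by
        simp only [mul_assoc]
        rw [← mul_assoc σ σ', h, one_mul] }

theorem conj_apply (Φ : End S ≃* End S) (σ σ' : End S) (h : σ * σ' = 1) (h' : σ' * σ = 1)
    (ν : End S) : conj Φ σ σ' h h' ν = σ' * Φ ν * σ := rfl

theorem isInner_of_conj_eq (Φ : End S ≃* End S) (σ σ' : End S) (h : σ * σ' = 1)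
    (h' : σ' * σ = 1) (hΦ : ∀ ν, conj Φ σ σ' h h' ν = ν) : IsInner Φ := by
  refine isInner_of_conj σ σ' h h' fun ν => ?_
  conv_rhs => rw [← hΦ ν, conj_apply]
  simp only [mul_assoc, h, mul_one]
  rw [← mul_assoc, h, one_mul]

end Homs

/-! ### Adjoining an identity, needed as the value of the empty word. -/

section WithOne

variable {S : Type u} [InverseSemigroup S]

instance : InverseSemigroup (WithOne S) where
  __ := (inferInstance : Semigroup (WithOne S))
  __ := (inferInstance : Inv (WithOne S))
  mul_inv_rev a b := by
    induction a with
    | one => change (1 * b)⁻¹ = b⁻¹ * 1; rw [one_mul, mul_one]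
    | coe a =>
      induction b with
      | one => change ((a : WithOne S) * 1)⁻¹ = 1 * (a : WithOne S)⁻¹; rw [one_mul, mul_one]
      | coe b => exact congrArg WithOne.coe (InverseSemigroup.mul_inv_rev a b)
  inv_inv a := by
    induction a with
    | one => rfl
    | coe a => exact congrArg WithOne.coe (InverseSemigroup.inv_inv a)
  mul_inv_mul a := by
    induction a with
    | one => rfl
    | coe a => exact congrArg WithOne.coe (InverseSemigroup.mul_inv_mul a)
  inv_mul_comm a b := by
    induction a with
    | one => change (1 : WithOne S) * (b⁻¹ * b) = (b⁻¹ * b) * 1; rw [one_mul, mul_one]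
    | coe a =>
      induction b with
      | one =>
        change ((a : WithOne S)⁻¹ * a) * 1 = 1 * ((a : WithOne S)⁻¹ * a)
        rw [one_mul, mul_one]
      | coe b => exact congrArg WithOne.coe (InverseSemigroup.inv_mul_comm a b)

end WithOne

end InverseSemigroup

/-! ### Munn trees and Munn's theorem. -/

open InverseSemigroup

/-- Pairs of a subset and an element of a group, with the multiplication of Munn trees. -/
@[ext]
structure MunnPair (G : Type u) where
  tree : Set G
  root : G

open scoped Pointwise in
instance (G : Type u) [Group G] : InverseSemigroup (MunnPair G) where
  mul a b := ⟨a.tree ∪ a.root • b.tree, a.root * b.root⟩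
  inv a := ⟨a.root⁻¹ • a.tree, a.root⁻¹⟩
  mul_assoc a b c := by
    apply MunnPair.ext
    · change a.tree ∪ a.root • b.tree ∪ (a.root * b.root) • c.tree =
        a.tree ∪ a.root • (b.tree ∪ b.root • c.tree)
      rw [Set.smul_set_union, smul_smul, Set.union_assoc]
    · exact mul_assoc _ _ _
  mul_inv_rev a b := by
    apply MunnPair.ext
    · change (a.root * b.root)⁻¹ • (a.tree ∪ a.root • b.tree) =
        b.root⁻¹ • b.tree ∪ b.root⁻¹ • a.root⁻¹ • a.tree
      rw [Set.smul_set_union, smul_smul, smul_smul, Set.union_comm, mul_inv_rev,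
        inv_mul_cancel_right]
    · exact mul_inv_rev _ _
  inv_inv a := by
    apply MunnPair.ext
    · change (a.root⁻¹)⁻¹ • a.root⁻¹ • a.tree = a.tree
      rw [smul_smul, inv_mul_cancel, one_smul]
    · exact inv_inv _
  mul_inv_mul a := by
    apply MunnPair.ext
    · change a.tree ∪ a.root • a.root⁻¹ • a.tree ∪ (a.root * a.root⁻¹) • a.tree = a.tree
      rw [smul_smul, mul_inv_cancel, one_smul, Set.union_self, Set.union_self]
    · exact (congrArg (· * a.root) (mul_inv_cancel a.root)).trans (one_mul _)
  inv_mul_comm a b := by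
    apply MunnPair.ext
    · change (a.root⁻¹ • a.tree ∪ a.root⁻¹ • a.tree) ∪ (a.root⁻¹ * a.root) •
        (b.root⁻¹ • b.tree ∪ b.root⁻¹ • b.tree) = (b.root⁻¹ • b.tree ∪ b.root⁻¹ • b.tree) ∪
        (b.root⁻¹ * b.root) • (a.root⁻¹ • a.tree ∪ a.root⁻¹ • a.tree)
      simp only [Set.union_self, inv_mul_cancel, one_smul]
      exact Set.union_comm _ _
    · change a.root⁻¹ * a.root * (b.root⁻¹ * b.root) = b.root⁻¹ * b.root * (a.root⁻¹ * a.root)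
      simp

namespace FreeInverseSemigroup

variable {X : Type u}

/-- The homomorphism with given values on the free generators. -/
noncomputable def lift {S : Type v} [InverseSemigroup S] (f : X → S) :
    Hom (FreeInverseSemigroup X) S := (existsUnique_hom f).choose

theorem lift_of {S : Type v} [InverseSemigroup S] (f : X → S) (x : X) : lift f (of x) = f x :=
  (existsUnique_hom f).choose_spec.1 x

theorem hom_ext_of {S : Type v} [InverseSemigroup S] {ν μ : Hom (FreeInverseSemigroup X) S}
    (h : ∀ x, ν (of x) = μ (of x)) : ν = μ :=
  (existsUnique_hom fun x => μ (of x)).unique h fun _ => rfl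

theorem induction {p : FreeInverseSemigroup X → Prop} (hof : ∀ x, p (of x))
    (hmul : ∀ a b, p a → p b → p (a * b)) (hinv : ∀ a, p a → p a⁻¹) (a) : p a := by
  obtain ⟨t⟩ := a
  induction t with
  | of x => exact hof x
  | mul a b iha ihb => exact hmul _ _ iha ihb
  | inv a iha => exact hinv _ iha

/-- Generators and their inverses. -/
def letter (z : X × Bool) : FreeInverseSemigroup X := if z.2 then of z.1 else (of z.1)⁻¹

/-- The inverse letter. -/
def bar (z : X × Bool) : X × Bool := (z.1, !z.2)

theorem bar_ne (z : X × Bool) : bar z ≠ z := by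
  rcases z with ⟨x, _ | _⟩ <;> simp [bar]

theorem eq_or_eq_bar {z w : X × Bool} (h : z.1 = w.1) : z = w ∨ z = bar w := by
  rcases z with ⟨x, _ | _⟩ <;> rcases w with ⟨y, _ | _⟩ <;> simp_all [bar]

theorem letter_bar (z : X × Bool) : letter (bar z) = (letter z)⁻¹ := by
  rcases z with ⟨x, _ | _⟩ <;> simp [letter, bar, InverseSemigroup.inv_inv]

/-- The Munn tree of an element, with its root. -/
noncomputable def munn : Hom (FreeInverseSemigroup X) (MunnPair (FreeGroup X)) :=
  lift fun x => ⟨{1, FreeGroup.of x}, FreeGroup.of x⟩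

open scoped Pointwise

theorem tree_mul {G : Type u} [Group G] (a b : MunnPair G) :
    (a * b).tree = a.tree ∪ a.root • b.tree := rfl

theorem root_mul {G : Type u} [Group G] (a b : MunnPair G) : (a * b).root = a.root * b.root := rfl

theorem tree_inv {G : Type u} [Group G] (a : MunnPair G) : (a⁻¹).tree = a.root⁻¹ • a.tree := rfl

theorem root_inv {G : Type u} [Group G] (a : MunnPair G) : (a⁻¹).root = a.root⁻¹ := rfl

theorem tree_mul_inv (a : FreeInverseSemigroup X) : (munn (a * a⁻¹)).tree = (munn a).tree := by
  rw [hom_mul, hom_inv, tree_mul, tree_inv, smul_smul, mul_inv_cancel, one_smul, Set.union_self]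

theorem tree_inv_mul (a : FreeInverseSemigroup X) :
    (munn (a⁻¹ * a)).tree = (munn a).root⁻¹ • (munn a).tree := by
  rw [hom_mul, hom_inv, tree_mul, tree_inv, root_inv, Set.union_self]

theorem root_of_isIdem {e : FreeInverseSemigroup X} (h : IsIdem e) : (munn e).root = 1 := by
  have h' := congrArg MunnPair.root (h.map munn)
  rwa [root_mul, root_inv, mul_inv_cancel, eq_comm] at h'

theorem munn_letter (z : X × Bool) :
    munn (letter z) = ⟨{1, FreeGroup.mk [z]}, FreeGroup.mk [z]⟩ := by
  rcases z with ⟨x, _ | _⟩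
  · simp only [letter, Bool.false_eq_true, if_false]
    rw [hom_inv, munn, lift_of]
    apply MunnPair.ext
    · rw [tree_inv]
      change (FreeGroup.of x)⁻¹ • ({1, FreeGroup.of x} : Set (FreeGroup X)) =
        {1, (FreeGroup.of x)⁻¹}
      rw [Set.smul_set_insert, Set.smul_set_singleton, smul_eq_mul, smul_eq_mul, mul_one,
        inv_mul_cancel, Set.pair_comm]
    · rfl
  · simp only [letter, if_true]
    rw [munn, lift_of]
    rfl

theorem one_mem_root_mem (a : FreeInverseSemigroup X) :
    1 ∈ (munn a).tree ∧ (munn a).root ∈ (munn a).tree ∧ (munn a).tree.Finite := by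
  induction a using induction with
  | hof x =>
    rw [munn, lift_of]
    simp
  | hmul a b ha hb =>
    rw [hom_mul, tree_mul, root_mul]
    exact ⟨Or.inl ha.1, Or.inr (Set.smul_mem_smul_set hb.2.1), ha.2.2.union (hb.2.2.smul_set)⟩
  | hinv a ha =>
    rw [hom_inv, tree_inv, root_inv]
    refine ⟨?_, ?_, ha.2.2.smul_set⟩
    · rw [Set.mem_inv_smul_set_iff, smul_eq_mul, mul_one]; exact ha.2.1
    · rw [Set.mem_inv_smul_set_iff, smul_eq_mul, mul_inv_cancel]; exact ha.1

theorem tree_subset_of_below {e f : FreeInverseSemigroup X} (he : IsIdem e) (h : Below e f) :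
    (munn f).tree ⊆ (munn e).tree := by
  have h' := congrArg MunnPair.tree (h.map munn)
  rw [tree_mul, root_of_isIdem he, one_smul] at h'
  exact Set.union_eq_left.mp h'

open Classical in
/-- The value of a reduced word, in the free inverse semigroup with an identity adjoined. -/
noncomputable def path (g : FreeGroup X) : WithOne (FreeInverseSemigroup X) :=
  (g.toWord.map fun z => (letter z : WithOne (FreeInverseSemigroup X))).prod

theorem path_one : path (1 : FreeGroup X) = 1 := by simp [path]

theorem path_mk_of_isReduced {l : List (X × Bool)} (h : FreeGroup.IsReduced l) :
    path (FreeGroup.mk l) =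
      (l.map fun z => (letter z : WithOne (FreeInverseSemigroup X))).prod := by
  classical
  simp only [path, FreeGroup.toWord_mk]
  rw [h.reduce_eq]

/-- Either the reduced word of g can be extended by z, or it ends in the inverse of z and the last
letter cancels. -/
theorem path_mul_letter (g : FreeGroup X) (z : X × Bool) :
    path (g * FreeGroup.mk [z]) = path g * letter z ∨
      path g = path (g * FreeGroup.mk [z]) * letter (bar z) := by
  classical
  have hg : FreeGroup.mk g.toWord = g := FreeGroup.mk_toWord
  have hr : FreeGroup.IsReduced g.toWord := FreeGroup.isReduced_toWord
  generalize g.toWord = l at hg hr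
  subst hg
  rw [path_mk_of_isReduced hr, FreeGroup.mul_mk]
  induction l using List.reverseRecOn with
  | nil =>
    left
    rw [List.nil_append, path_mk_of_isReduced (by simp)]
    simp
  | append_singleton l w _ =>
    by_cases hw : w = bar z
    · right
      have hl : FreeGroup.IsReduced l := hr.infix ⟨[], [w], by simp⟩
      have : FreeGroup.mk (l ++ [w] ++ [z]) = FreeGroup.mk l := by
        subst hw
        rw [List.append_assoc]
        apply FreeGroup.Red.exact.2
        refine ⟨l, Relation.ReflTransGen.single ?_, Relation.ReflTransGen.refl⟩
        have := FreeGroup.Red.Step.not_rev (L₁ := l) (L₂ := []) (x := z.1) (b := z.2)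
        simpa [bar] using this
      rw [this, path_mk_of_isReduced hl]
      simp [hw]
    · left
      have : FreeGroup.IsReduced (l ++ [w] ++ [z]) := by
        unfold FreeGroup.IsReduced at *
        rw [List.isChain_append]
        refine ⟨hr, by simp, ?_⟩
        intro a ha b hb
        simp at ha hb
        subst ha; subst hb
        intro h
        by_contra h2
        apply hw
        rcases eq_or_eq_bar h with h3 | h3
        · exact absurd (congrArg Prod.snd h3) h2
        · exact h3
      rw [path_mk_of_isReduced this]
      simp [mul_assoc]

/-- `a` has Munn tree `A` and root `g`, expressed in terms of the order of the idempotents. -/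
structure IsMunn (a : WithOne (FreeInverseSemigroup X)) (A : Set (FreeGroup X))
    (g : FreeGroup X) : Prop where
  mem : g ∈ A
  below : ∀ h ∈ A, Below (a * a⁻¹) (path h * (path h)⁻¹)
  eq : a = a * a⁻¹ * path g
  greatest : ∀ e, IsIdem e → (∀ h ∈ A, Below e (path h * (path h)⁻¹)) → Below e (a * a⁻¹)

theorem isMunn_one : IsMunn (1 : WithOne (FreeInverseSemigroup X)) {1} 1 where
  mem := rfl
  below := by rintro h rfl; rw [path_one]; rfl
  eq := by rw [path_one]; rfl
  greatest e _ _ := mul_one e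

/-- Appending a letter walks along one edge of the tree. If the reduced word gets shorter instead of
longer, the idempotent aa⁻¹ already lies below that of the longer path and absorbs the backtracking.
-/
theorem IsMunn.mul_letter {a : WithOne (FreeInverseSemigroup X)} {A : Set (FreeGroup X)}
    {g : FreeGroup X} (h : IsMunn a A g) (z : X × Bool) :
    IsMunn (a * (letter z : WithOne (FreeInverseSemigroup X))) (A ∪ {g * FreeGroup.mk [z]}) (g * FreeGroup.mk [z]) := by
  set k := g * FreeGroup.mk [z] with hk
  have key : a * letter z = a * a⁻¹ * path k := by
    rcases path_mul_letter g z with h1 | h1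
    · conv_lhs => rw [h.eq]
      rw [h1, mul_assoc (a * a⁻¹)]
    · have h2 : path g * letter z = path g * (path g)⁻¹ * path k := by
        have h3 : (letter (bar z) : WithOne (FreeInverseSemigroup X)) = (letter z : WithOne _)⁻¹ := by
          rw [letter_bar, WithOne.coe_inv]
        rw [← hk, h3] at h1
        rw [h1, InverseSemigroup.mul_inv_rev, InverseSemigroup.inv_inv]
        simp only [mul_assoc]
        have h4 := (isIdem_inv_mul (letter z : WithOne (FreeInverseSemigroup X))).comm
          (isIdem_inv_mul (path k))
        simp only [mul_assoc] at h4
        rw [h4, mul_inv_mul']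
      conv_lhs => rw [h.eq]
      rw [mul_assoc, h2, ← mul_assoc, h.below g h.mem]
  have key2 : a * letter z * (a * letter z)⁻¹ = a * a⁻¹ * (path k * (path k)⁻¹) := by
    rw [key, InverseSemigroup.mul_inv_rev, (isIdem_mul_inv a).inv_eq]
    have h4 := (isIdem_mul_inv (path k)).comm (isIdem_mul_inv a)
    simp only [mul_assoc] at h4 ⊢
    rw [h4]
    simp only [inv_mul_inv']
  have hi := (isIdem_mul_inv a).comm (isIdem_mul_inv (path k))
  refine ⟨Or.inr rfl, ?_, ?_, ?_⟩
  · rintro w (hw | rfl)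
    · rw [key2]
      exact (h.below w hw).mul_right (isIdem_mul_inv _) (isIdem_mul_inv _)
    · rw [key2, hi]
      exact (isIdem_mul_inv (path k)).below_self.mul_right (isIdem_mul_inv _) (isIdem_mul_inv _)
  · rw [key2, mul_assoc (a * a⁻¹), InverseSemigroup.mul_inv_mul, key]
  · intro e he hA
    rw [key2]
    unfold Below
    rw [← mul_assoc]
    have h5 : e * (a * a⁻¹) = e := h.greatest e he fun w hw => hA w (Or.inl hw)
    rw [h5]
    exact hA k (Or.inr rfl)

theorem IsMunn.mul {a : WithOne (FreeInverseSemigroup X)} {A : Set (FreeGroup X)}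
    {g : FreeGroup X} (h : IsMunn a A g) (b : FreeInverseSemigroup X) :
    IsMunn (a * (b : WithOne (FreeInverseSemigroup X))) (A ∪ g • (munn b).tree) (g * (munn b).root) := by
  have base (z : X × Bool) {a : WithOne (FreeInverseSemigroup X)} {A : Set (FreeGroup X)}
      {g : FreeGroup X} (h : IsMunn a A g) :
      IsMunn (a * (letter z : WithOne (FreeInverseSemigroup X))) (A ∪ g • (munn (letter z)).tree) (g * (munn (letter z)).root) := by
    have h1 := h.mul_letter z
    rw [munn_letter]
    have : A ∪ g • ({1, FreeGroup.mk [z]} : Set (FreeGroup X)) = A ∪ {g * FreeGroup.mk [z]} := by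
      rw [Set.smul_set_insert, Set.smul_set_singleton, smul_eq_mul, smul_eq_mul, mul_one,
        Set.union_insert, Set.insert_eq_of_mem (Set.mem_union_left _ h.mem)]
    simpa only [this] using h1
  -- The statement for b⁻¹ is carried along so that the induction passes through inversion.
  have main : ∀ b : FreeInverseSemigroup X,
      (∀ a A g, IsMunn a A g → IsMunn (a * (b : WithOne (FreeInverseSemigroup X))) (A ∪ g • (munn b).tree) (g * (munn b).root)) ∧
      (∀ a A g, IsMunn a A g →
        IsMunn (a * ((b⁻¹ : FreeInverseSemigroup X) : WithOne (FreeInverseSemigroup X))) (A ∪ g • (munn b⁻¹).tree)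
          (g * (munn b⁻¹).root)) := by
    intro b
    induction b using induction with
    | hof x => exact ⟨fun a A g h => base (x, true) h, fun a A g h => base (x, false) h⟩
    | hmul b c hb hc =>
      constructor
      · intro a A g h
        have := hc.1 _ _ _ (hb.1 _ _ _ h)
        rw [hom_mul, tree_mul, root_mul, Set.smul_set_union, smul_smul, ← Set.union_assoc,
          ← mul_assoc, WithOne.coe_mul, ← mul_assoc]
        exact this
      · intro a A g h
        have := hb.2 _ _ _ (hc.2 _ _ _ h)
        rw [InverseSemigroup.mul_inv_rev, hom_mul, tree_mul, root_mul, Set.smul_set_union,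
          smul_smul, ← Set.union_assoc, ← mul_assoc, WithOne.coe_mul, ← mul_assoc]
        exact this
    | hinv b hb => exact ⟨hb.2, by simpa only [InverseSemigroup.inv_inv] using hb.1⟩
  exact (main b).1 a A g h

theorem isMunn (a : FreeInverseSemigroup X) :
    IsMunn (a : WithOne (FreeInverseSemigroup X)) (munn a).tree (munn a).root := by
  have h := isMunn_one.mul a
  rw [one_mul, one_mul, one_smul, Set.union_eq_right.mpr] at h
  · exact h
  · rintro _ rfl; exact (one_mem_root_mem a).1

/-- Munn's theorem. -/
theorem munn_injective : Function.Injective (munn (X := X)) := by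
  intro a b hab
  apply WithOne.coe_injective
  have ha := isMunn a
  have hb := isMunn b
  rw [hab] at ha
  rw [ha.eq, hb.eq, Below.antisymm (isIdem_mul_inv _) (isIdem_mul_inv _)
    (hb.greatest _ (isIdem_mul_inv _) ha.below) (ha.greatest _ (isIdem_mul_inv _) hb.below)]

/-- Otherwise the infinitely many points gⁿa would all lie in A. -/
theorem _root_.Set.Finite.smul_eq_self_imp {G : Type u} [Group G] [IsMulTorsionFree G]
    {A : Set G} (hA : A.Finite) {a g : G} (ha : a ∈ A) (h : g • A = A) : g = 1 := by
  by_contra hg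
  have hmem : ∀ n : ℕ, g ^ n * a ∈ A := by
    intro n
    induction n with
    | zero => simpa
    | succ n ih =>
      rw [pow_succ', mul_assoc, ← h]
      exact Set.smul_mem_smul_set ih
  have hinj : Function.Injective fun n : ℕ => g ^ n * a := fun m n hmn =>
    IsMulTorsionFree.pow_right_injective hg (mul_right_cancel hmn)
  exact (Set.infinite_range_of_injective hinj) (hA.subset (Set.range_subset_iff.2 hmem))

/-- The first idempotent gives the tree, the second its translate by the inverse root. Two possible
roots differ by a translation preserving a finite tree, so they agree. -/
theorem eq_of_mul_inv_of_inv_mul {a b : FreeInverseSemigroup X} (h₁ : a * a⁻¹ = b * b⁻¹)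
    (h₂ : a⁻¹ * a = b⁻¹ * b) : a = b := by
  have t₁ := congrArg (fun c => (munn c).tree) h₁
  have t₂ := congrArg (fun c => (munn c).tree) h₂
  simp only [tree_mul_inv, tree_inv_mul] at t₁ t₂
  apply munn_injective
  apply MunnPair.ext t₁
  rw [t₁] at t₂
  have h := (one_mem_root_mem b).2.2.smul_eq_self_imp (g := (munn b).root * (munn a).root⁻¹)
    (one_mem_root_mem b).1 (by rw [mul_smul, t₂, smul_smul, mul_inv_cancel, one_smul])
  exact (mul_inv_eq_one.mp h).symm

end FreeInverseSemigroup

/-! ### The top of the semilattice: single edges and paths of two edges. -/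

namespace FreeInverseSemigroup

variable {X : Type u}

section Order

/-- The idempotent whose Munn tree is a single edge at the identity. -/
def edge (z : X × Bool) : FreeInverseSemigroup X := letter z * (letter z)⁻¹

/-- The idempotent whose Munn tree is a path of two edges from the identity. -/
def edges (z w : X × Bool) : FreeInverseSemigroup X :=
  letter z * letter w * (letter z * letter w)⁻¹

theorem isIdem_edge (z : X × Bool) : IsIdem (edge z) := isIdem_mul_inv _

theorem isIdem_edges (z w : X × Bool) : IsIdem (edges z w) := isIdem_mul_inv _

theorem edge_bar (z : X × Bool) : edge (bar z) = (letter z)⁻¹ * letter z := by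
  rw [edge, letter_bar, InverseSemigroup.inv_inv]

theorem edges_below (z w : X × Bool) : Below (edges z w) (edge z) := below_mul_left _ _

theorem exists_below_edge (a : FreeInverseSemigroup X) (ha : IsIdem a) :
    ∃ z, Below a (edge z) := by
  have key : ∀ a : FreeInverseSemigroup X,
      (∃ z, Below (a * a⁻¹) (edge z)) ∧ ∃ z, Below (a⁻¹ * a) (edge z) := by
    intro a
    induction a using induction with
    | hof x =>
      refine ⟨⟨(x, true), (isIdem_mul_inv _).below_self⟩, ⟨(x, false), ?_⟩⟩
      have := (isIdem_edge (x, false)).below_self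
      simpa [edge, letter, InverseSemigroup.inv_inv] using this
    | hmul a b ha hb =>
      refine ⟨ha.1.imp fun z hz => (below_mul_left a b).trans hz,
        hb.2.imp fun z hz => Below.trans ?_ hz⟩
      simpa only [InverseSemigroup.mul_inv_rev, InverseSemigroup.inv_inv] using
        below_mul_left b⁻¹ a⁻¹
    | hinv a ha => rw [InverseSemigroup.inv_inv]; exact ha.symm
  have := (key a).1
  rwa [ha] at this

theorem mk_inj {l m : List (X × Bool)} (hl : FreeGroup.IsReduced l) (hm : FreeGroup.IsReduced m)
    (h : FreeGroup.mk l = FreeGroup.mk m) : l = m := by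
  classical
  have := congrArg FreeGroup.toWord h
  rwa [FreeGroup.toWord_mk, FreeGroup.toWord_mk, hl.reduce_eq, hm.reduce_eq] at this

theorem isReduced_pair {z w : X × Bool} (h : w ≠ bar z) : FreeGroup.IsReduced [z, w] := by
  rw [FreeGroup.isReduced_cons_cons]
  refine ⟨fun h1 => ?_, FreeGroup.IsReduced.singleton⟩
  rcases eq_or_eq_bar h1.symm with h2 | h2
  · rw [h2]
  · exact absurd h2 h

theorem tree_edge (z : X × Bool) : (munn (edge z)).tree = {1, FreeGroup.mk [z]} := by
  rw [edge, tree_mul_inv, munn_letter]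

theorem tree_letter_mul (z w : X × Bool) :
    (munn (letter z * letter w)).tree = {1, FreeGroup.mk [z], FreeGroup.mk [z, w]} := by
  rw [hom_mul, tree_mul, munn_letter, munn_letter]
  ext g
  simp [Set.smul_set_insert]
  tauto

theorem tree_edges (z w : X × Bool) :
    (munn (edges z w)).tree = {1, FreeGroup.mk [z], FreeGroup.mk [z, w]} := by
  rw [edges, tree_mul_inv, tree_letter_mul]

theorem edge_eq_of_below {z w : X × Bool} (h : Below (edge z) (edge w)) : z = w := by
  have h1 := tree_subset_of_below (isIdem_edge z) h
  rw [tree_edge, tree_edge] at h1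
  have h2 : FreeGroup.mk [w] = 1 ∨ FreeGroup.mk [w] = FreeGroup.mk [z] := by
    simpa using h1 (Set.mem_insert_of_mem _ rfl)
  rcases h2 with h2 | h2
  · exact absurd (mk_inj FreeGroup.IsReduced.singleton FreeGroup.IsReduced.nil h2) (by simp)
  · have := mk_inj FreeGroup.IsReduced.singleton FreeGroup.IsReduced.singleton h2
    simp at this
    exact this.symm

theorem edge_injective {z w : X × Bool} (h : edge z = edge w) : z = w :=
  edge_eq_of_below (h ▸ (isIdem_edge z).below_self)

theorem eq_edge_of_below {z : X × Bool} {f : FreeInverseSemigroup X} (hf : IsIdem f)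
    (h : Below (edge z) f) : f = edge z := by
  obtain ⟨w, hw⟩ := exists_below_edge f hf
  obtain rfl := edge_eq_of_below (h.trans hw)
  exact Below.antisymm hf (isIdem_edge z) hw h

theorem edges_ne_edge {z w v : X × Bool} (h : w ≠ bar z) : edges z w ≠ edge v := by
  intro h1
  have h2 := congrArg (fun a => (munn a).tree) h1
  simp only [tree_edge, tree_edges] at h2
  have h3 : FreeGroup.mk [z, w] = 1 ∨ FreeGroup.mk [z, w] = FreeGroup.mk [v] := by
    have : FreeGroup.mk [z, w] ∈ ({1, FreeGroup.mk [v]} : Set (FreeGroup X)) := by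
      rw [← h2]; simp
    simpa using this
  rcases h3 with h3 | h3
  · exact absurd (mk_inj (isReduced_pair h) FreeGroup.IsReduced.nil h3) (by simp)
  · exact absurd (mk_inj (isReduced_pair h) FreeGroup.IsReduced.singleton h3) (by simp)

theorem below_coe {e f : FreeInverseSemigroup X} :
    Below (e : WithOne (FreeInverseSemigroup X)) f ↔ Below e f := by
  unfold Below
  rw [← WithOne.coe_mul, WithOne.coe_inj]

theorem path_mk_singleton (z : X × Bool) :
    path (FreeGroup.mk [z]) * (path (FreeGroup.mk [z]))⁻¹ = edge z := by
  rw [path_mk_of_isReduced FreeGroup.IsReduced.singleton]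
  simp [edge]

theorem path_mk_pair {z w : X × Bool} (h : w ≠ bar z) :
    path (FreeGroup.mk [z, w]) * (path (FreeGroup.mk [z, w]))⁻¹ = edges z w := by
  rw [path_mk_of_isReduced (isReduced_pair h)]
  simp [edges]

theorem below_path {f : FreeInverseSemigroup X} (hf : IsIdem f) {h : FreeGroup X}
    (hh : h ∈ (munn f).tree) :
    Below (f : WithOne (FreeInverseSemigroup X)) (path h * (path h)⁻¹) := by
  have := (isMunn f).below h hh
  rwa [← WithOne.coe_inv, ← WithOne.coe_mul, hf] at this

theorem below_of_forall_path {e f : FreeInverseSemigroup X} (he : IsIdem e) (hf : IsIdem f)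
    (H : ∀ h ∈ (munn f).tree,
      Below (e : WithOne (FreeInverseSemigroup X)) (path h * (path h)⁻¹)) : Below e f := by
  have := (isMunn f).greatest e (by
    unfold IsIdem; rw [← WithOne.coe_inv, ← WithOne.coe_mul, he]) H
  rw [← WithOne.coe_inv, ← WithOne.coe_mul, hf] at this
  exact below_coe.1 this

/-- The tree of f has a vertex off the edge z. Its reduced word either starts with another letter,
or starts with z and continues; a prefix of length one or two gives the idempotent above f. -/
theorem below_edge_cases {f : FreeInverseSemigroup X} {z : X × Bool} (hf : IsIdem f)
    (h : Below f (edge z)) (hne : f ≠ edge z) :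
    (∃ w, w ≠ z ∧ Below f (edge w)) ∨ ∃ w, w ≠ bar z ∧ Below f (edges z w) := by
  classical
  have h1 : ∃ k ∈ (munn f).tree,
      ¬ Below (edge z : WithOne (FreeInverseSemigroup X)) (path k * (path k)⁻¹) := by
    by_contra! hcon
    exact hne (eq_edge_of_below hf (below_of_forall_path (isIdem_edge z) hf hcon))
  obtain ⟨k, hk, hkz⟩ := h1
  have hfk := below_path hf hk
  have hkm : FreeGroup.mk k.toWord = k := FreeGroup.mk_toWord
  have hr : FreeGroup.IsReduced k.toWord := FreeGroup.isReduced_toWord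
  rw [← hkm, path_mk_of_isReduced hr] at hkz hfk
  generalize k.toWord = l at hr hkz hfk
  rcases l with _ | ⟨w, l⟩
  · exact absurd (mul_one _) hkz
  by_cases hw : w = z
  · right
    subst hw
    rcases l with _ | ⟨v, l⟩
    · refine absurd ?_ hkz
      rw [List.map_singleton, List.prod_singleton]
      exact below_coe.2 (isIdem_edge w).below_self
    · refine ⟨v, ?_, ?_⟩
      · rintro rfl
        rw [FreeGroup.isReduced_cons_cons] at hr
        simpa [bar] using hr.1
      · rw [← below_coe]
        refine hfk.trans ?_
        rw [List.map_cons, List.map_cons, List.prod_cons, List.prod_cons, ← mul_assoc]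
        exact below_mul_left _ _
  · left
    refine ⟨w, hw, ?_⟩
    rw [← below_coe]
    refine hfk.trans ?_
    rw [List.map_cons, List.prod_cons]
    exact below_mul_left _ _

theorem eq_of_edges_below {f : FreeInverseSemigroup X} {z w : X × Bool} (hw : w ≠ bar z)
    (hf : IsIdem f) (h : Below (edges z w) f) : f = edge z ∨ f = edges z w := by
  have hsub := tree_subset_of_below (isIdem_edges z w) h
  rw [tree_edges] at hsub
  by_cases hm : FreeGroup.mk [z, w] ∈ (munn f).tree
  · right
    have h1 := below_path hf hm
    rw [path_mk_pair hw] at h1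
    exact Below.antisymm hf (isIdem_edges z w) (below_coe.1 h1) h
  · left
    apply eq_edge_of_below hf
    apply below_of_forall_path (isIdem_edge z) hf
    intro k hk
    rcases hsub hk with rfl | rfl | rfl
    · rw [path_one]; exact mul_one _
    · rw [path_mk_singleton]; exact below_coe.2 (isIdem_edge z).below_self
    · exact absurd hk hm

open scoped Pointwise

theorem norm_pair {z w : X × Bool} [DecidableEq X] (h : w ≠ bar z) :
    FreeGroup.norm (FreeGroup.mk [z, w]) = 2 := by
  rw [FreeGroup.norm, FreeGroup.toWord_mk, (isReduced_pair h).reduce_eq]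
  rfl

theorem norm_singleton (z : X × Bool) [DecidableEq X] :
    FreeGroup.norm (FreeGroup.mk [z]) = 1 := by
  rw [FreeGroup.norm, FreeGroup.toWord_mk, FreeGroup.IsReduced.singleton.reduce_eq]
  rfl

/-- An element with `cc⁻¹` and `c⁻¹c` paths of two edges is determined by their first edges. -/
theorem eq_letter_mul_letter {c : FreeInverseSemigroup X} {z w z' w' : X × Bool} (hw : w ≠ bar z)
    (hw' : w' ≠ bar z') (hz : z ≠ z') (h : c * c⁻¹ = edges z w) (h' : c⁻¹ * c = edges z' w') :
    c = letter z * letter (bar z') := by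
  classical
  have t := congrArg (fun a => (munn a).tree) h
  have t' := congrArg (fun a => (munn a).tree) h'
  simp only [tree_mul_inv, tree_inv_mul, tree_edges] at t t'
  have hmem := (one_mem_root_mem c).2.1
  have hinv : ∀ v : X × Bool, (FreeGroup.mk [v])⁻¹ = FreeGroup.mk [bar v] := fun v => rfl
  have hone : ∀ v : X × Bool, FreeGroup.mk [v] ≠ 1 := by
    intro v hv
    simpa [hv] using norm_singleton v
  have h2 : ∀ v, FreeGroup.mk [z', w'] ≠ FreeGroup.mk [v] := fun v hv => by
    simpa [hv, norm_singleton] using norm_pair hw'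
  have h2' : FreeGroup.mk [z', w'] ≠ 1 := fun hv => by
    simpa [hv] using norm_pair hw'
  have h3 : ∀ v, FreeGroup.mk [z, w] ≠ FreeGroup.mk [v] := fun v hv => by
    simpa [hv, norm_singleton] using norm_pair hw
  have hsing : ∀ {u v : X × Bool}, FreeGroup.mk [u] = FreeGroup.mk [v] → u = v := by
    intro u v huv
    simpa using mk_inj FreeGroup.IsReduced.singleton FreeGroup.IsReduced.singleton huv
  rw [t] at t' hmem
  -- The root is a vertex of the path. The initial vertex would force z = z'; the middle one would
  -- leave no vertex at distance two after re-rooting. So the root is the far end, and reading the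
  -- path backwards gives w = `bar z'`.
  rcases hmem with hg | hg | hg
  · rw [hg, inv_one, one_smul] at t'
    have : FreeGroup.mk [z'] ∈ ({1, FreeGroup.mk [z], FreeGroup.mk [z, w]} : Set (FreeGroup X)) := by
      rw [t']; simp
    rcases this with h4 | h4 | h4
    · exact absurd h4 (hone z')
    · exact absurd (hsing h4).symm hz
    · exact absurd h4.symm (h3 z')
  · have : FreeGroup.mk [z', w'] ∈ (munn c).root⁻¹ •
        ({1, FreeGroup.mk [z], FreeGroup.mk [z, w]} : Set (FreeGroup X)) := by
      rw [t']; simp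
    rw [hg, Set.mem_inv_smul_set_iff, smul_eq_mul] at this
    have hzw : FreeGroup.mk [z, w] = FreeGroup.mk [z] * FreeGroup.mk [w] := rfl
    rcases this with h4 | h4 | h4
    · exact absurd ((eq_inv_of_mul_eq_one_right h4).trans (hinv z)) (h2 _)
    · exact absurd (mul_eq_left.1 h4) h2'
    · rw [hzw] at h4
      exact absurd (mul_left_cancel h4) (h2 _)
  · have : FreeGroup.mk [z'] ∈ (munn c).root⁻¹ •
        ({1, FreeGroup.mk [z], FreeGroup.mk [z, w]} : Set (FreeGroup X)) := by
      rw [t']; simp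
    rw [hg, Set.mem_inv_smul_set_iff, smul_eq_mul] at this
    have hzw : FreeGroup.mk [z, w] = FreeGroup.mk [z] * FreeGroup.mk [w] := rfl
    have hfin : w = bar z' := by
      rcases this with h4 | h4 | h4
      · exfalso
        have h5 := eq_inv_of_mul_eq_one_left h4
        rw [hinv] at h5
        exact h3 _ h5
      · rw [hzw, mul_assoc, mul_eq_left] at h4
        exact hsing ((eq_inv_of_mul_eq_one_left h4).trans (hinv z'))
      · exact absurd (mul_eq_left.1 h4) (hone z')
    apply munn_injective
    apply MunnPair.ext
    · rw [t, tree_letter_mul, hfin]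
    · rw [hg, hom_mul, root_mul, munn_letter, munn_letter, hfin]; rfl

end Order

end FreeInverseSemigroup

/-! ### The action of Φ on F through collapsing endomorphisms. -/

namespace FreeInverseSemigroup

variable {X : Type u}

/-- The endomorphism that sends all free generators to `a`. -/
noncomputable def collapse (a : FreeInverseSemigroup X) : End (FreeInverseSemigroup X) :=
  lift fun _ => a

theorem collapse_of (a : FreeInverseSemigroup X) (x : X) : collapse a (of x) = a := lift_of _ x

theorem collapse_apply_of_isIdem {e : FreeInverseSemigroup X} (he : IsIdem e)
    (w : FreeInverseSemigroup X) : collapse e w = e := by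
  induction w using induction with
  | hof x => exact collapse_of e x
  | hmul a b ha hb => rw [hom_mul, ha, hb, he.mul_self]
  | hinv a ha => rw [hom_inv, ha, he.inv_eq]

theorem mul_collapse (ν : End (FreeInverseSemigroup X)) (a : FreeInverseSemigroup X) :
    ν * collapse a = collapse (ν a) :=
  hom_ext_of fun x => by rw [end_mul_apply, collapse_of, collapse_of]

theorem collapse_mul {e : FreeInverseSemigroup X} (he : IsIdem e)
    (ν : End (FreeInverseSemigroup X)) : collapse e * ν = collapse e :=
  hom_ext fun w => by
    rw [end_mul_apply, collapse_apply_of_isIdem he, collapse_apply_of_isIdem he]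

section Action

variable (Φ : End (FreeInverseSemigroup X) ≃* End (FreeInverseSemigroup X)) (x₀ : X)

/-- The map of the free inverse semigroup that comes from the action of `Φ` on the endomorphisms
that send all free generators to the same element. -/
noncomputable def act (a : FreeInverseSemigroup X) : FreeInverseSemigroup X :=
  Φ (collapse a) (of x₀)

theorem act_apply (ν : End (FreeInverseSemigroup X)) (a : FreeInverseSemigroup X) :
    act Φ x₀ (ν a) = Φ ν (act Φ x₀ a) := by
  rw [act, ← mul_collapse, map_mul, end_mul_apply, act]

theorem map_collapse_apply {e : FreeInverseSemigroup X} (he : IsIdem e)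
    (w : FreeInverseSemigroup X) :
    Φ (collapse e) w = act Φ x₀ e ∧ IsIdem (act Φ x₀ e) := by
  -- Being a left zero is preserved by Φ. Composing with a constant endomorphism then shows that the
  -- image is constant, with an idempotent value.
  have hz : ∀ μ, Φ (collapse e) * μ = Φ (collapse e) := by
    intro μ
    obtain ⟨ν, rfl⟩ := Φ.surjective μ
    rw [← map_mul, collapse_mul he]
  have hk : IsIdem (of x₀ * (of x₀)⁻¹) := isIdem_mul_inv _
  have hc : ∀ w, Φ (collapse e) w = Φ (collapse e) (of x₀ * (of x₀)⁻¹) := by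
    intro w
    conv_lhs => rw [← hz (collapse (of x₀ * (of x₀)⁻¹)), end_mul_apply,
      collapse_apply_of_isIdem hk]
  have h0 : act Φ x₀ e = Φ (collapse e) (of x₀ * (of x₀)⁻¹) := hc _
  rw [h0]
  exact ⟨hc w, hk.map _⟩

theorem isIdem_act {e : FreeInverseSemigroup X} (he : IsIdem e) : IsIdem (act Φ x₀ e) :=
  (map_collapse_apply Φ x₀ he e).2

theorem map_collapse {e : FreeInverseSemigroup X} (he : IsIdem e) :
    Φ (collapse e) = collapse (act Φ x₀ e) :=
  hom_ext fun w => by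
    rw [(map_collapse_apply Φ x₀ he w).1, collapse_apply_of_isIdem (isIdem_act Φ x₀ he)]

theorem act_symm_act {e : FreeInverseSemigroup X} (he : IsIdem e) :
    act Φ.symm x₀ (act Φ x₀ e) = e := by
  rw [act, ← map_collapse Φ x₀ he, MulEquiv.symm_apply_apply, collapse_of]

theorem act_act_symm {e : FreeInverseSemigroup X} (he : IsIdem e) :
    act Φ x₀ (act Φ.symm x₀ e) = e := act_symm_act Φ.symm x₀ he

theorem act_injective {e f : FreeInverseSemigroup X} (he : IsIdem e) (hf : IsIdem f)
    (h : act Φ x₀ e = act Φ x₀ f) : e = f := by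
  rw [← act_symm_act Φ x₀ he, h, act_symm_act Φ x₀ hf]

theorem act_mul_inv {x₁ : X} (h : act Φ x₀ (of x₁ * (of x₁)⁻¹) = of x₁ * (of x₁)⁻¹)
    (ν : End (FreeInverseSemigroup X)) :
    Φ ν (of x₁) * (Φ ν (of x₁))⁻¹ = act Φ x₀ (ν (of x₁) * (ν (of x₁))⁻¹) := by
  rw [← hom_inv ν, ← hom_mul ν, act_apply, h, hom_mul, hom_inv]

theorem act_inv_mul {x₁ : X} (h : act Φ x₀ ((of x₁)⁻¹ * of x₁) = (of x₁)⁻¹ * of x₁)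
    (ν : End (FreeInverseSemigroup X)) :
    (Φ ν (of x₁))⁻¹ * Φ ν (of x₁) = act Φ x₀ ((ν (of x₁))⁻¹ * ν (of x₁)) := by
  rw [← hom_inv ν, ← hom_mul ν, act_apply, h, hom_mul, hom_inv]

/-- If `act` fixes all edges, it describes `Φ`. -/
theorem map_of_eq_act (h : ∀ z, act Φ x₀ (edge z) = edge z) (ν : End (FreeInverseSemigroup X))
    (x : X) :
    act Φ x₀ (ν (of x) * (ν (of x))⁻¹) =
        act Φ x₀ (ν (of x)) * (act Φ x₀ (ν (of x)))⁻¹ ∧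
      act Φ x₀ ((ν (of x))⁻¹ * ν (of x)) =
        (act Φ x₀ (ν (of x)))⁻¹ * act Φ x₀ (ν (of x)) ∧
      Φ ν (of x) = act Φ x₀ (ν (of x)) := by
  have h₁ : ∀ x : X, act Φ x₀ (of x * (of x)⁻¹) = of x * (of x)⁻¹ := fun x => h (x, true)
  have h₂ : ∀ x : X, act Φ x₀ ((of x)⁻¹ * of x) = (of x)⁻¹ * of x := fun x => by
    have := h (x, false)
    simpa [edge, letter, InverseSemigroup.inv_inv] using this
  have k₁ := act_mul_inv Φ x₀ (h₁ x₀) (collapse (ν (of x)))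
  have k₂ := act_inv_mul Φ x₀ (h₂ x₀) (collapse (ν (of x)))
  rw [collapse_of] at k₁ k₂
  refine ⟨k₁.symm, k₂.symm, eq_of_mul_inv_of_inv_mul ?_ ?_⟩
  · rw [act_mul_inv Φ x₀ (h₁ x), ← k₁]; rfl
  · rw [act_inv_mul Φ x₀ (h₂ x), ← k₂]; rfl

end Action

/-! ### At least two generators. -/

section TwoGenerators

variable (Φ : End (FreeInverseSemigroup X) ≃* End (FreeInverseSemigroup X)) (x₀ : X)

/-- The product transported by `act` is commutative and natural under substitution, so one value t
on the pair xx⁻¹, yy⁻¹ governs it. It suffices to show that t is the ordinary product. -/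
theorem act_mul {x y : X} (hxy : x ≠ y) {e f : FreeInverseSemigroup X} (he : IsIdem e)
    (hf : IsIdem f) : act Φ x₀ (e * f) = act Φ x₀ e * act Φ x₀ f := by
  classical
  set S := act Φ x₀ with hS
  set T := act Φ.symm x₀ with hT
  have sub : ∀ a b : FreeInverseSemigroup X, ∃ ν : End (FreeInverseSemigroup X),
      ν (of x) = a ∧ ν (of y) = b ∧ ∀ z, ν (of z) = a ∨ ν (of z) = b := by
    intro a b
    refine ⟨lift fun z => if z = y then b else a, ?_, ?_, fun z => ?_⟩
    · rw [lift_of, if_neg hxy]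
    · rw [lift_of, if_pos rfl]
    · rw [lift_of]; split_ifs <;> simp
  have hidem : ∀ a : FreeInverseSemigroup X, IsIdem a → a * a⁻¹ = a := fun _ h => h
  set p : FreeInverseSemigroup X := of x * (of x)⁻¹ with hp
  set q : FreeInverseSemigroup X := of y * (of y)⁻¹ with hq
  have ip : IsIdem p := isIdem_mul_inv _
  have iq : IsIdem q := isIdem_mul_inv _
  have hpq : p ≠ q := fun h => hxy (congrArg Prod.fst (edge_injective (z := (x, true))
    (w := (y, true)) h))
  have htr : ∀ ν : End (FreeInverseSemigroup X),
      ν (S (T p * T q)) = S (T (ν p) * T (ν q)) := by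
    intro ν
    have h1 := act_apply Φ x₀ (Φ.symm ν) (T p * T q)
    rw [MulEquiv.apply_symm_apply, hom_mul, ← act_apply Φ.symm, ← act_apply Φ.symm] at h1
    exact h1.symm
  have hcomm : S (T p * T q) = S (T q * T p) :=
    congrArg S ((isIdem_act _ _ ip).comm (isIdem_act _ _ iq))
  -- Sending x to p and y to q fixes t and has image in {p, q, pq}. Swapping x and y also fixes t by
  -- commutativity, which rules out p and q.
  have ht : S (T p * T q) = p * q := by
    obtain ⟨ν, hν1, hν2, hν⟩ := sub p q
    have hfix : ν (S (T p * T q)) = S (T p * T q) := by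
      rw [htr, hom_mul, hom_mul, hom_inv, hom_inv, hν1, hν2, hidem p ip, hidem q iq]
    have hrange : ∀ w, ν w = p ∨ ν w = q ∨ ν w = p * q := by
      intro w
      induction w using induction with
      | hof z => rcases hν z with h | h <;> simp [h]
      | hmul a b ha hb =>
        have e1 := ip.mul_self
        have e2 := iq.mul_self
        have e3 := iq.comm ip
        have e4 := ip.mul_self_left q
        have e5 : q * (p * q) = p * q := by rw [iq.left_comm ip, e2]
        rw [hom_mul]
        rcases ha with ha | ha | ha <;> rcases hb with hb | hb | hb <;> rw [ha, hb] <;>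
          simp only [mul_assoc, e1, e2, e3, e4, e5, true_or, or_true]
      | hinv a ha =>
        rw [hom_inv]
        rcases ha with ha | ha | ha <;> rw [ha]
        · left; exact ip.inv_eq
        · right; left; exact iq.inv_eq
        · right; right; exact (ip.mul iq).inv_eq
    obtain ⟨π, hπ1, hπ2, -⟩ := sub (of y) (of x)
    have hswap : π (S (T p * T q)) = S (T p * T q) := by
      rw [htr, hom_mul, hom_mul, hom_inv, hom_inv, hπ1, hπ2, ← hp, ← hq, hcomm]
    have πp : π p = q := by rw [hp, hom_mul, hom_inv, hπ1]
    have πq : π q = p := by rw [hq, hom_mul, hom_inv, hπ2]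
    rcases hrange (S (T p * T q)) with h | h | h
    · rw [hfix] at h
      rw [h, πp] at hswap
      exact absurd hswap.symm hpq
    · rw [hfix] at h
      rw [h, πq] at hswap
      exact absurd hswap hpq
    · rw [← hfix, h]
  obtain ⟨ν, hν1, hν2, -⟩ := sub (S e) (S f)
  have iSe : IsIdem (S e) := isIdem_act _ _ he
  have iSf : IsIdem (S f) := isIdem_act _ _ hf
  have h1 := htr ν
  have νp : ν p = S e := by rw [hp, hom_mul, hom_inv, hν1]; exact iSe
  have νq : ν q = S f := by rw [hq, hom_mul, hom_inv, hν2]; exact iSf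
  rw [ht, hom_mul, νp, νq, hT, hS, act_symm_act Φ x₀ he, act_symm_act Φ x₀ hf] at h1
  exact h1.symm

theorem act_below {x y : X} (hxy : x ≠ y) {e f : FreeInverseSemigroup X} (he : IsIdem e)
    (hf : IsIdem f) (h : Below e f) : Below (act Φ x₀ e) (act Φ x₀ f) := by
  unfold Below at *
  rw [← act_mul Φ x₀ hxy he hf, h]

/-- Edges are exactly the maximal idempotents, and both `act` and its inverse on idempotents
preserve the order. -/
theorem exists_act_edge {x y : X} (hxy : x ≠ y) (z : X × Bool) :
    ∃ w, act Φ x₀ (edge z) = edge w := by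
  have iS := isIdem_act Φ x₀ (isIdem_edge z)
  obtain ⟨w, hw⟩ := exists_below_edge _ iS
  have iT := isIdem_act Φ.symm x₀ (isIdem_edge w)
  have h1 := act_below Φ.symm x₀ hxy iS (isIdem_edge w) hw
  rw [act_symm_act Φ x₀ (isIdem_edge z)] at h1
  refine ⟨w, ?_⟩
  rw [← eq_edge_of_below iT h1, act_act_symm Φ x₀ (isIdem_edge w)]

open scoped Pointwise in
theorem ncard_tree_inv_mul (a : FreeInverseSemigroup X) :
    (munn (a⁻¹ * a)).tree.ncard = (munn (a * a⁻¹)).tree.ncard := by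
  rw [tree_mul_inv, tree_inv_mul, Set.ncard_smul_set]

theorem ncard_tree_edge (z : X × Bool) : (munn (edge z)).tree.ncard = 2 := by
  rw [tree_edge, Set.ncard_pair]
  intro h
  simpa using mk_inj FreeGroup.IsReduced.nil FreeGroup.IsReduced.singleton h

theorem ncard_tree_edges {z w : X × Bool} (h : w ≠ bar z) :
    (munn (edges z w)).tree.ncard = 3 := by
  classical
  rw [tree_edges, Set.ncard_eq_three]
  refine ⟨_, _, _, fun h1 => ?_, fun h1 => ?_, fun h1 => ?_, rfl⟩
  · simpa using mk_inj FreeGroup.IsReduced.nil FreeGroup.IsReduced.singleton h1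
  · simpa using mk_inj FreeGroup.IsReduced.nil (isReduced_pair h) h1
  · simpa using mk_inj FreeGroup.IsReduced.singleton (isReduced_pair h) h1

theorem act_edge_bar {z w v : X × Bool} (hz : act Φ x₀ (edge z) = edge w)
    (hz' : act Φ x₀ (edge (bar z)) = edge v) : v = bar w := by
  classical
  by_cases h1 : v.1 = w.1
  · rcases eq_or_eq_bar h1 with h | h
    · subst h
      exact absurd (edge_injective (act_injective Φ x₀ (isIdem_edge _) (isIdem_edge _)
        (hz'.trans hz.symm))) (bar_ne z)
    · exact h
  exfalso
  set e := act Φ x₀ (edge z)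
  have he : IsIdem e := isIdem_act Φ x₀ (isIdem_edge z)
  set f := act Φ x₀ (edges z z)
  have hf : IsIdem f := isIdem_act Φ x₀ (isIdem_edges z z)
  have hlet : ∀ {ν : End (FreeInverseSemigroup X)} {u : X × Bool} {a : FreeInverseSemigroup X},
      IsIdem a → ν (of u.1) = a → ν (edge u) = a := by
    rintro ν ⟨u, _ | _⟩ a ha hν
    · replace hν : ν (of u) = a := hν
      simp only [edge, letter, Bool.false_eq_true, if_false]
      simp only [hom_mul, hom_inv, hν, ha.inv_eq, ha.mul_self]
    · simp only [edge, letter, if_true]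
      rw [hom_mul, hom_inv, hν, ha]
  -- If w and v lie over different generators, their edges can be mapped independently. Pulled back
  -- through Φ, this sends zz⁻¹ to a tree with two vertices and z⁻¹z to one with three, although
  -- these images are translates of each other.
  let ν : End (FreeInverseSemigroup X) := lift fun u => if u = v.1 then f else e
  have ν1 : ν (edge w) = e := hlet he (by
    change lift _ _ = e
    rw [lift_of, if_neg (Ne.symm h1)])
  have ν2 : ν (edge v) = f := hlet hf (by
    change lift _ _ = f
    rw [lift_of, if_pos rfl])
  have h2 := act_apply Φ.symm x₀ ν (edge w)
  have h3 := act_apply Φ.symm x₀ ν (edge v)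
  rw [ν1, ← hz, act_symm_act Φ x₀ (isIdem_edge z)] at h2
  rw [ν2, ← hz', act_symm_act Φ x₀ (isIdem_edge _), act_symm_act Φ x₀ (isIdem_edges z z)] at h3
  have h4 := ncard_tree_inv_mul (Φ.symm ν (letter z))
  rw [← hom_inv, ← hom_mul, ← hom_mul, ← edge_bar] at h4
  change (munn (Φ.symm ν (edge (bar z)))).tree.ncard = (munn (Φ.symm ν (edge z))).tree.ncard at h4
  rw [← h3, ← h2, ncard_tree_edge, ncard_tree_edges (bar_ne z).symm] at h4
  omega

/-- If `act` fixes all edges, it is the identity. -/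
theorem act_eq_self {x y : X} (hxy : x ≠ y) (h : ∀ z, act Φ x₀ (edge z) = edge z)
    (a : FreeInverseSemigroup X) : act Φ x₀ a = a := by
  classical
  have h' : ∀ z, act Φ.symm x₀ (edge z) = edge z := fun z => by
    conv_lhs => rw [← h z]
    rw [act_symm_act Φ x₀ (isIdem_edge z)]
  have hL : ∀ a : FreeInverseSemigroup X,
      act Φ x₀ (a * a⁻¹) = act Φ x₀ a * (act Φ x₀ a)⁻¹ ∧
      act Φ x₀ (a⁻¹ * a) = (act Φ x₀ a)⁻¹ * act Φ x₀ a := fun a => by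
    have := map_of_eq_act Φ x₀ h (collapse a) x₀
    rw [collapse_of] at this
    exact ⟨this.1, this.2.1⟩
  have hΦ : ∀ ν x, Φ ν (of x) = act Φ x₀ (ν (of x)) := fun ν x => (map_of_eq_act Φ x₀ h ν x).2.2
  have hinv : ∀ a, act Φ x₀ a⁻¹ = (act Φ x₀ a)⁻¹ := by
    intro a
    have h1 := hL a⁻¹
    rw [InverseSemigroup.inv_inv] at h1
    apply eq_of_mul_inv_of_inv_mul
    · rw [← h1.1, (hL a).2, InverseSemigroup.inv_inv]
    · rw [← h1.2, (hL a).1, InverseSemigroup.inv_inv]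
  have hof : ∀ x : X, act Φ x₀ (of x) = of x := by
    intro x
    apply eq_of_mul_inv_of_inv_mul
    · rw [← (hL _).1]; exact h (x, true)
    · rw [← (hL _).2]
      have := h (bar (x, true))
      rw [edge_bar] at this
      exact this
  -- The only idempotents above a two-edge path are itself and its first edge. This order property
  -- passes to the image and characterises the two-edge paths below the fixed edge z.
  have hedges : ∀ z w : X × Bool, w ≠ bar z →
      ∃ v, v ≠ bar z ∧ act Φ x₀ (edges z w) = edges z v := by
    intro z w hzw
    have hi := isIdem_edges z w
    have hb := act_below Φ x₀ hxy hi (isIdem_edge z) (edges_below z w)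
    rw [h] at hb
    have key : ∀ f, IsIdem f → Below (act Φ x₀ (edges z w)) f →
        f = edge z ∨ f = act Φ x₀ (edges z w) := by
      intro f hf hbf
      have h1 := act_below Φ.symm x₀ hxy (isIdem_act Φ x₀ hi) hf hbf
      rw [act_symm_act Φ x₀ hi] at h1
      rcases eq_of_edges_below hzw (isIdem_act Φ.symm x₀ hf) h1 with h2 | h2
      · left
        rw [← act_act_symm Φ x₀ hf, h2, h]
      · right
        rw [← h2, act_act_symm Φ x₀ hf]
    have hne : act Φ x₀ (edges z w) ≠ edge z := by
      rw [← h z]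
      intro h1
      exact edges_ne_edge hzw (act_injective Φ x₀ hi (isIdem_edge z) h1)
    rcases below_edge_cases (isIdem_act Φ x₀ hi) hb hne with ⟨v, hv, hv'⟩ | ⟨v, hv, hv'⟩
    · exfalso
      rcases key _ (isIdem_edge v) hv' with h1 | h1
      · exact hv (edge_injective h1)
      · rw [← h1] at hb
        exact hv (edge_eq_of_below hb)
    · refine ⟨v, hv, ?_⟩
      rcases key _ (isIdem_edges z v) hv' with h1 | h1
      · exact absurd h1 (edges_ne_edge hv)
      · exact h1.symm
  -- The second edges w and v need not be known: `eq_letter_mul_letter` recovers the element from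
  -- the two first edges.
  have hxy' : act Φ x₀ (of x * of y) = of x * of y := by
    obtain ⟨w, hw, h1⟩ := hedges (x, true) (y, true) (by simp [bar])
    obtain ⟨v, hv, h2⟩ := hedges (y, false) (x, false) (by simp [bar])
    have e1 : of x * of y * (of x * of y)⁻¹ = edges (x, true) (y, true) := rfl
    have e2 : (of x * of y)⁻¹ * (of x * of y) = edges (y, false) (x, false) := by
      simp [edges, letter, InverseSemigroup.mul_inv_rev, InverseSemigroup.inv_inv]
    have := eq_letter_mul_letter (c := act Φ x₀ (of x * of y)) hw hv (by simp)
      (by rw [← (hL _).1, e1, h1]) (by rw [← (hL _).2, e2, h2])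
    exact this
  -- Substituting a for x and b for y in the fixed element xy turns equivariance into
  -- multiplicativity.
  have hmul : ∀ a b, act Φ x₀ (a * b) = act Φ x₀ a * act Φ x₀ b := by
    intro a b
    let ν : End (FreeInverseSemigroup X) := lift fun z => if z = y then b else a
    have ν1 : ν (of x) = a := by change lift _ _ = a; rw [lift_of, if_neg hxy]
    have ν2 : ν (of y) = b := by change lift _ _ = b; rw [lift_of, if_pos rfl]
    have h1 := act_apply Φ x₀ ν (of x * of y)
    rw [hxy', hom_mul, hom_mul, hΦ, hΦ, ν1, ν2] at h1
    exact h1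
  induction a using induction with
  | hof x => exact hof x
  | hmul a b ha hb => rw [hmul, ha, hb]
  | hinv a ha => rw [hinv, ha]

theorem map_eq_self_of_act {Φ : End (FreeInverseSemigroup X) ≃* End (FreeInverseSemigroup X)}
    {x₀ : X} (h : ∀ a, act Φ x₀ a = a) (ν : End (FreeInverseSemigroup X)) : Φ ν = ν :=
  hom_ext_of fun x => by
    rw [(map_of_eq_act Φ x₀ (fun z => h _) ν x).2.2, h]

theorem hom_letter {ν : End (FreeInverseSemigroup X)} {f : X × Bool → X × Bool}
    (hf : ∀ z, f (bar z) = bar (f z)) (h : ∀ x, ν (of x) = letter (f (x, true))) (z : X × Bool) :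
    ν (letter z) = letter (f z) := by
  rcases z with ⟨x, _ | _⟩
  · have h1 : letter (x, false) = (of x)⁻¹ := rfl
    have h2 := hf (x, true)
    rw [h1, hom_inv, h, ← letter_bar, ← h2]
    rfl
  · exact h x

theorem isInner_of_ne {x y : X} (hxy : x ≠ y) : IsInner Φ := by
  choose f hf using exists_act_edge Φ x hxy
  choose g hg using exists_act_edge Φ.symm x hxy
  have hfb : ∀ z, f (bar z) = bar (f z) := fun z => act_edge_bar Φ x (hf z) (hf (bar z))
  have hgb : ∀ z, g (bar z) = bar (g z) := fun z => act_edge_bar Φ.symm x (hg z) (hg (bar z))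
  have hgf : ∀ z, g (f z) = z := fun z => by
    apply edge_injective
    rw [← hg, ← hf, act_symm_act Φ x (isIdem_edge z)]
  have hfg : ∀ z, f (g z) = z := fun z => by
    apply edge_injective
    rw [← hf, ← hg, act_act_symm Φ x (isIdem_edge z)]
  let σ : End (FreeInverseSemigroup X) := lift fun x => letter (f (x, true))
  let σ' : End (FreeInverseSemigroup X) := lift fun x => letter (g (x, true))
  have hσ : ∀ z, σ (letter z) = letter (f z) := hom_letter hfb fun x => lift_of _ x
  have hσ' : ∀ z, σ' (letter z) = letter (g z) := hom_letter hgb fun x => lift_of _ x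
  have h1 : σ * σ' = 1 := hom_ext_of fun x => by
    change σ (σ' (letter (x, true))) = letter (x, true)
    rw [hσ', hσ, hfg]
  have h2 : σ' * σ = 1 := hom_ext_of fun x => by
    change σ' (σ (letter (x, true))) = letter (x, true)
    rw [hσ, hσ', hgf]
  refine isInner_of_conj_eq Φ σ σ' h1 h2 (map_eq_self_of_act (x₀ := x)
    (act_eq_self _ x hxy fun z => ?_))
  rw [act, conj_apply, map_collapse Φ x (isIdem_edge z), hf, mul_collapse,
    collapse_mul ((isIdem_edge _).map _), collapse_of, edge, hom_mul, hom_inv, hσ', hgf]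
  rfl

end TwoGenerators

end FreeInverseSemigroup

/-! ### One generator: the model by integer intervals. -/

/-- Munn trees over a single generator: an interval of integers and an element of it. -/
@[ext]
structure Span where
  lo : ℤ
  hi : ℤ
  root : ℤ

namespace Span

instance : InverseSemigroup Span where
  mul a b := ⟨min a.lo (a.root + b.lo), max a.hi (a.root + b.hi), a.root + b.root⟩
  inv a := ⟨a.lo - a.root, a.hi - a.root, -a.root⟩
  mul_assoc a b c := by
    apply Span.ext
    · change min (min a.lo (a.root + b.lo)) (a.root + b.root + c.lo) =
        min a.lo (a.root + min b.lo (b.root + c.lo))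
      omega
    · change max (max a.hi (a.root + b.hi)) (a.root + b.root + c.hi) =
        max a.hi (a.root + max b.hi (b.root + c.hi))
      omega
    · exact add_assoc _ _ _
  mul_inv_rev a b := by
    apply Span.ext
    · change min a.lo (a.root + b.lo) - (a.root + b.root) =
        min (b.lo - b.root) (-b.root + (a.lo - a.root))
      omega
    · change max a.hi (a.root + b.hi) - (a.root + b.root) =
        max (b.hi - b.root) (-b.root + (a.hi - a.root))
      omega
    · exact neg_add_rev _ _
  inv_inv a := by
    apply Span.ext
    · change a.lo - a.root - -a.root = a.lo
      omega
    · change a.hi - a.root - -a.root = a.hi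
      omega
    · exact neg_neg _
  mul_inv_mul a := by
    apply Span.ext
    · change min (min a.lo (a.root + (a.lo - a.root))) (a.root + -a.root + a.lo) = a.lo
      omega
    · change max (max a.hi (a.root + (a.hi - a.root))) (a.root + -a.root + a.hi) = a.hi
      omega
    · change a.root + -a.root + a.root = a.root
      omega
  inv_mul_comm a b := by
    apply Span.ext
    · change min (min (a.lo - a.root) (-a.root + a.lo))
          (-a.root + a.root + min (b.lo - b.root) (-b.root + b.lo)) =
        min (min (b.lo - b.root) (-b.root + b.lo))
          (-b.root + b.root + min (a.lo - a.root) (-a.root + a.lo))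
      omega
    · change max (max (a.hi - a.root) (-a.root + a.hi))
          (-a.root + a.root + max (b.hi - b.root) (-b.root + b.hi)) =
        max (max (b.hi - b.root) (-b.root + b.hi))
          (-b.root + b.root + max (a.hi - a.root) (-a.root + a.hi))
      omega
    · change -a.root + a.root + (-b.root + b.root) = -b.root + b.root + (-a.root + a.root)
      omega

theorem mul_def (a b : Span) :
    a * b = ⟨min a.lo (a.root + b.lo), max a.hi (a.root + b.hi), a.root + b.root⟩ := rfl

theorem inv_def (a : Span) : a⁻¹ = ⟨a.lo - a.root, a.hi - a.root, -a.root⟩ := rfl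

/-- The triples that come from elements of the free inverse semigroup. -/
def Valid (a : Span) : Prop :=
  a.lo ≤ 0 ∧ 0 ≤ a.hi ∧ a.lo ≤ a.root ∧ a.root ≤ a.hi ∧ a.lo < a.hi

/-- Composition of endomorphisms in terms of the values at the generator. -/
def comp (a b : Span) : Span :=
  if 0 ≤ a.root then ⟨a.lo + a.root * b.lo, a.hi + a.root * (b.hi - 1), a.root * b.root⟩
  else ⟨a.lo + a.root * (b.hi - 1), a.hi + a.root * b.lo, a.root * b.root⟩

theorem comp_mul (a b c : Span) : comp a (b * c) = comp a b * comp a c := by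
  rcases le_or_gt 0 a.root with h | h
  · simp only [comp, mul_def, if_pos h, Span.mk.injEq]
    refine ⟨?_, ?_, by ring⟩
    · rw [mul_min_of_nonneg _ _ h, mul_add]
      omega
    · have : max b.hi (b.root + c.hi) - 1 = max (b.hi - 1) (b.root + (c.hi - 1)) := by omega
      rw [this, mul_max_of_nonneg _ _ h, mul_add]
      omega
  · simp only [comp, mul_def, if_neg (not_le.2 h), Span.mk.injEq]
    refine ⟨?_, ?_, by ring⟩
    · have : max b.hi (b.root + c.hi) - 1 = max (b.hi - 1) (b.root + (c.hi - 1)) := by omega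
      have hm := (antitone_mul_left h.le).map_max (a := b.hi - 1) (b := b.root + (c.hi - 1))
      rw [this, hm, mul_add]
      omega
    · have hm := (antitone_mul_left h.le).map_min (a := b.lo) (b := b.root + c.lo)
      rw [hm, mul_add]
      omega

theorem comp_inv (a b : Span) : comp a b⁻¹ = (comp a b)⁻¹ := by
  rcases le_or_gt 0 a.root with h | h
  · simp only [comp, inv_def, if_pos h, Span.mk.injEq]
    refine ⟨?_, ?_, ?_⟩ <;> ring
  · simp only [comp, inv_def, if_neg (not_le.2 h), Span.mk.injEq]
    refine ⟨?_, ?_, ?_⟩ <;> ring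

end Span

namespace FreeInverseSemigroup

variable {X : Type u}

/-- The image of the Munn tree under the homomorphism that identifies all generators. -/
noncomputable def span : Hom (FreeInverseSemigroup X) Span := lift fun _ => ⟨0, 1, 1⟩

theorem span_of (x : X) : span (of x) = ⟨0, 1, 1⟩ := lift_of _ x

theorem valid_span (a : FreeInverseSemigroup X) : (span a).Valid := by
  induction a using induction with
  | hof x => rw [span_of]; simp [Span.Valid]
  | hmul a b ha hb =>
    rw [hom_mul, Span.mul_def]
    unfold Span.Valid at *
    dsimp only
    omega
  | hinv a ha =>
    rw [hom_inv, Span.inv_def]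
    unfold Span.Valid at *
    dsimp only
    omega

section OneGenerator

variable {x₀ : X}

open scoped Pointwise

theorem munn_eq_of_span (hX : ∀ x : X, x = x₀) (a : FreeInverseSemigroup X) :
    munn a = ⟨(fun k : ℤ => FreeGroup.of x₀ ^ k) '' Set.Icc (span a).lo (span a).hi,
      FreeGroup.of x₀ ^ (span a).root⟩ := by
  have hsmul : ∀ n l r : ℤ, FreeGroup.of x₀ ^ n •
      ((fun k : ℤ => FreeGroup.of x₀ ^ k) '' Set.Icc l r) =
        (fun k : ℤ => FreeGroup.of x₀ ^ k) '' Set.Icc (n + l) (n + r) := by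
    intro n l r
    rw [← Set.image_const_add_Icc, Set.image_image, ← Set.image_smul, Set.image_image]
    simp only [smul_eq_mul, zpow_add]
  induction a using induction with
  | hof x =>
    rw [span_of, munn, lift_of, hX x]
    apply MunnPair.ext
    · have : Set.Icc (0 : ℤ) 1 = {0, 1} := by ext k; simp; omega
      simp [this, Set.image_pair]
    · simp
  | hmul a b ha hb =>
    have va := valid_span a
    have vb := valid_span b
    rw [hom_mul, hom_mul, ha, hb, Span.mul_def]
    apply MunnPair.ext
    · rw [tree_mul]
      dsimp only
      rw [hsmul, ← Set.image_union]
      congr 1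
      ext k
      unfold Span.Valid at va vb
      simp only [Set.mem_union, Set.mem_Icc]
      omega
    · exact (zpow_add _ _ _).symm
  | hinv a ha =>
    rw [hom_inv, hom_inv, ha, Span.inv_def]
    apply MunnPair.ext
    · rw [tree_inv]
      dsimp only
      rw [← zpow_neg, hsmul]
      congr 2 <;> ring
    · exact (zpow_neg _ _).symm

theorem span_injective (hX : ∀ x : X, x = x₀) : Function.Injective (span (X := X)) := by
  intro a b h
  apply munn_injective
  rw [munn_eq_of_span hX a, munn_eq_of_span hX b, h]

/-- The edge from k to k + 1 is replaced by the interval of ν(x₀) shifted by k times its root. Edges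
of [l, r] start at l, …, r - 1, hence the `- 1` in `Span.comp`; a negative root exchanges the two
extremes. -/
theorem span_apply (hX : ∀ x : X, x = x₀) (ν : End (FreeInverseSemigroup X)) (w : FreeInverseSemigroup X) :
    span (ν w) = (span (ν (of x₀))).comp (span w) := by
  induction w using induction with
  | hof x =>
    rw [span_of, hX x]
    unfold Span.comp
    split_ifs <;> simp
  | hmul a b ha hb => rw [hom_mul, hom_mul, hom_mul, Span.comp_mul, ha, hb]
  | hinv a ha => rw [hom_inv, hom_inv, hom_inv, Span.comp_inv, ha]

variable (x₀) in
/-- The interval and root of the value of an endomorphism at the generator. -/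
noncomputable def endSpan (ν : End (FreeInverseSemigroup X)) : Span := span (ν (of x₀))

theorem endSpan_mul (hX : ∀ x : X, x = x₀) (ν μ : End (FreeInverseSemigroup X)) :
    endSpan x₀ (ν * μ) = (endSpan x₀ ν).comp (endSpan x₀ μ) := span_apply hX ν _

theorem endSpan_injective (hX : ∀ x : X, x = x₀) : Function.Injective (endSpan x₀) := fun ν μ h =>
  hom_ext_of fun x => by rw [hX x]; exact span_injective hX h

theorem endSpan_collapse (a : FreeInverseSemigroup X) : endSpan x₀ (collapse a) = span a := by
  rw [endSpan, collapse_of]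

/-- While an end of the interval can be shortened without losing validity, a shift splits off on the
left. What remains is a nonzero power of the generator or an idempotent with a single edge. -/
theorem exists_endSpan_eq (hX : ∀ x : X, x = x₀) : ∀ (n : ℕ) (t : Span), t.Valid → (t.hi - t.lo).toNat ≤ n →
    ∃ ν, endSpan x₀ ν = t := by
  intro n
  induction n with
  | zero => intro t ht hn; unfold Span.Valid at ht; omega
  | succ n ih =>
    rintro ⟨l, r, m⟩ ht hn
    unfold Span.Valid at ht
    dsimp only at ht hn
    by_cases hA : l + 1 ≤ 0 ∧ l + 1 ≤ m ∧ l + 1 < r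
    · obtain ⟨ν, hν⟩ := ih ⟨l + 1, r, m⟩ (by unfold Span.Valid; dsimp only; omega)
        (by dsimp only; omega)
      refine ⟨collapse ((of x₀)⁻¹ * of x₀ * of x₀) * ν, ?_⟩
      rw [endSpan_mul hX, endSpan_collapse, hν]
      simp [Span.comp, hom_mul, hom_inv, span_of, Span.mul_def, Span.inv_def]
    by_cases hB : 0 ≤ r - 1 ∧ m ≤ r - 1 ∧ l < r - 1
    · obtain ⟨ν, hν⟩ := ih ⟨l, r - 1, m⟩ (by unfold Span.Valid; dsimp only; omega)
        (by dsimp only; omega)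
      refine ⟨collapse (of x₀ * of x₀ * (of x₀)⁻¹) * ν, ?_⟩
      rw [endSpan_mul hX, endSpan_collapse, hν]
      simp [Span.comp, hom_mul, hom_inv, span_of, Span.mul_def, Span.inv_def]
      omega
    rcases lt_trichotomy m 0 with hm | rfl | hm
    · obtain ⟨rfl, rfl⟩ : l = m ∧ r = 0 := by omega
      by_cases h1 : l = -1
      · subst h1
        refine ⟨collapse (of x₀)⁻¹, ?_⟩
        rw [endSpan_collapse, hom_inv, span_of]
        rfl
      · obtain ⟨ν, hν⟩ := ih ⟨l + 1, 0, l + 1⟩ (by unfold Span.Valid; dsimp only; omega)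
          (by dsimp only; omega)
        refine ⟨collapse (ν (of x₀) * (of x₀)⁻¹), ?_⟩
        rw [endSpan] at hν
        rw [endSpan_collapse, hom_mul, hν]
        simp [hom_inv, span_of, Span.mul_def, Span.inv_def]
        omega
    · have h1 : l = 0 ∧ r = 1 ∨ l = -1 ∧ r = 0 := by omega
      rcases h1 with ⟨rfl, rfl⟩ | ⟨rfl, rfl⟩
      · refine ⟨collapse (of x₀ * (of x₀)⁻¹), ?_⟩
        rw [endSpan_collapse]
        simp [hom_mul, hom_inv, span_of, Span.mul_def, Span.inv_def]
      · refine ⟨collapse ((of x₀)⁻¹ * of x₀), ?_⟩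
        rw [endSpan_collapse]
        simp [hom_mul, hom_inv, span_of, Span.mul_def, Span.inv_def]
    · obtain ⟨rfl, rfl⟩ : l = 0 ∧ r = m := by omega
      by_cases h1 : r = 1
      · subst h1
        refine ⟨collapse (of x₀), ?_⟩
        rw [endSpan_collapse, span_of]
      · obtain ⟨ν, hν⟩ := ih ⟨0, r - 1, r - 1⟩ (by unfold Span.Valid; dsimp only; omega)
          (by dsimp only; omega)
        refine ⟨collapse (ν (of x₀) * of x₀), ?_⟩
        rw [endSpan] at hν
        rw [endSpan_collapse, hom_mul, hν]
        simp [span_of, Span.mul_def]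
        omega

theorem exists_endSpan (hX : ∀ x : X, x = x₀) {t : Span} (ht : t.Valid) : ∃ ν, endSpan x₀ ν = t :=
  exists_endSpan_eq hX _ t ht le_rfl

theorem valid_endSpan (ν : End (FreeInverseSemigroup X)) : (endSpan x₀ ν).Valid := valid_span _

end OneGenerator

end FreeInverseSemigroup

/-! ### One generator: automorphisms of the monoid of endomorphisms. -/

namespace FreeInverseSemigroup

section OneGenerator

variable {X : Type u} {x₀ : X}

theorem endSpan_one : endSpan x₀ (1 : End (FreeInverseSemigroup X)) = ⟨0, 1, 1⟩ := span_of x₀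

/-- The only nontrivial automorphism is preserved. -/
theorem map_reflection (hX : ∀ x : X, x = x₀)
    (Φ : End (FreeInverseSemigroup X) ≃* End (FreeInverseSemigroup X))
    {U : End (FreeInverseSemigroup X)} (hU : endSpan x₀ U = ⟨-1, 0, -1⟩) : Φ U = U := by
  have hUU : U * U = 1 := endSpan_injective hX (by
    rw [endSpan_mul hX, hU, endSpan_one]; rfl)
  have h1 : Φ U * Φ U = 1 := by rw [← map_mul, hUU, map_one]
  have h2 : Φ U ≠ 1 := fun h => by
    rw [← map_one Φ] at h
    have := congrArg (endSpan x₀) (Φ.injective h)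
    rw [hU, endSpan_one] at this
    simp at this
  have hv := valid_endSpan (x₀ := x₀) (Φ U)
  have h3 := congrArg (endSpan x₀) h1
  rw [endSpan_mul hX, endSpan_one] at h3
  apply endSpan_injective hX
  rw [hU]
  have h4 : endSpan x₀ (Φ U) ≠ ⟨0, 1, 1⟩ := fun h => h2 (endSpan_injective hX (by
    rw [h, endSpan_one]))
  generalize endSpan x₀ (Φ U) = t at *
  obtain ⟨l, r, n⟩ := t
  unfold Span.Valid Span.comp at *
  dsimp only at *
  split_ifs at h3 with hn <;> simp only [Span.mk.injEq] at h3 <;> obtain ⟨h5, h6, h7⟩ := h3 <;>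
    rcases mul_self_eq_one_iff.1 h7 with rfl | rfl
  · exact absurd (by rw [Span.mk.injEq]; omega) h4
  · omega
  · omega
  · rw [Span.mk.injEq]; omega

/-- The left shift is irreducible in the monoid of endomorphisms. -/
theorem eq_of_mul_eq_shift (hX : ∀ x : X, x = x₀)
    {A U ν μ : End (FreeInverseSemigroup X)}
    (hA : endSpan x₀ A = ⟨-1, 1, 1⟩) (hU : endSpan x₀ U = ⟨-1, 0, -1⟩) (h : ν * μ = A) :
    ν = 1 ∨ ν = U ∨ μ = 1 ∨ μ = U := by
  have h1 := congrArg (endSpan x₀) h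
  rw [endSpan_mul hX, hA] at h1
  simp only [← (endSpan_injective hX).eq_iff, endSpan_one, hU]
  have v1 := valid_endSpan (x₀ := x₀) ν
  have v2 := valid_endSpan (x₀ := x₀) μ
  generalize endSpan x₀ ν = s at *
  generalize endSpan x₀ μ = t at *
  obtain ⟨l, r, n⟩ := s
  obtain ⟨l', r', n'⟩ := t
  unfold Span.Valid Span.comp at *
  dsimp only at *
  -- Both roots are 1 or both are -1, and then interval length minus one is additive. Here it totals
  -- 1, so one factor has length one and is a unit.
  split_ifs at h1 with hn <;> simp only [Span.mk.injEq] at h1 ⊢ <;> obtain ⟨h5, h6, h7⟩ := h1 <;>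
    rcases Int.eq_one_or_neg_one_of_mul_eq_one' h7 with ⟨rfl, rfl⟩ | ⟨rfl, rfl⟩ <;> omega

theorem exists_eq_mul (hX : ∀ x : X, x = x₀)
    {A ν : End (FreeInverseSemigroup X)} {s t : Span} (ht : t.Valid)
    (hA : endSpan x₀ A = s) (h : endSpan x₀ ν = s.comp t) :
    ∃ μ, endSpan x₀ μ = t ∧ ν = A * μ := by
  obtain ⟨μ, hμ⟩ := exists_endSpan hX ht
  exact ⟨μ, hμ, endSpan_injective hX (by rw [endSpan_mul hX, hA, hμ, h])⟩

/-- The two shifts are permuted. -/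
theorem map_shift (hX : ∀ x : X, x = x₀)
    (Φ : End (FreeInverseSemigroup X) ≃* End (FreeInverseSemigroup X))
    {A B U : End (FreeInverseSemigroup X)} (hA : endSpan x₀ A = ⟨-1, 1, 1⟩)
    (hB : endSpan x₀ B = ⟨0, 2, 1⟩) (hU : endSpan x₀ U = ⟨-1, 0, -1⟩) :
    Φ A = A ∨ Φ A = B := by
  have ΦU := map_reflection hX Φ hU
  have hirr : ∀ ν μ, ν * μ = Φ A → ν = 1 ∨ ν = U ∨ μ = 1 ∨ μ = U := by
    intro ν μ h
    have h1 : Φ.symm ν * Φ.symm μ = A := by rw [← map_mul, h, MulEquiv.symm_apply_apply]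
    have := eq_of_mul_eq_shift hX hA hU h1
    simpa only [MulEquiv.symm_apply_eq, map_one, ΦU] using this
  have hne : Φ A * U ≠ U * Φ A := by
    intro h
    rw [← ΦU, ← map_mul, ← map_mul] at h
    have := congrArg (endSpan x₀) (Φ.injective h)
    rw [endSpan_mul hX, endSpan_mul hX, hA, hU] at this
    simp [Span.comp] at this
  -- The two shifts A and UAU commute; this later excludes AU and BU as values of Φ A.
  have hcomm : Φ A * (U * Φ A * U) = U * Φ A * U * Φ A := by
    rw [← ΦU, ← map_mul, ← map_mul, ← map_mul, ← map_mul]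
    congr 1
    apply endSpan_injective hX
    simp only [endSpan_mul hX, hA, hU]
    simp [Span.comp]
  -- With root zero, Φ A could not distinguish the right factors 1 and U, whereas A does.
  have hzero : (endSpan x₀ (Φ A)).root ≠ 0 := by
    intro h0
    apply (show (A * 1 ≠ A * U) from fun h => by
      have := congrArg (endSpan x₀) h
      rw [endSpan_mul hX, endSpan_mul hX, hA, hU, endSpan_one] at this
      simp [Span.comp] at this)
    apply Φ.injective
    apply endSpan_injective hX
    rw [map_mul, map_mul, endSpan_mul hX, endSpan_mul hX]
    simp [Span.comp, h0]
  have hAne : A ≠ 1 ∧ A ≠ U ∧ B ≠ 1 ∧ B ≠ U := by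
    simp [← (endSpan_injective hX).ne_iff, hA, hB, hU, endSpan_one]
  have hv := valid_endSpan (x₀ := x₀) (Φ A)
  -- If a shift splits off on the left, irreducibility makes the cofactor a unit. Otherwise Φ A
  -- sends the generator to one of its nonzero powers and so commutes with U, against `hne`.
  have key : Φ A = A ∨ Φ A = B ∨ Φ A = A * U ∨ Φ A = B * U := by
    rcases hs : endSpan x₀ (Φ A) with ⟨l, r, n⟩
    rw [hs] at hv hzero
    unfold Span.Valid at hv
    dsimp only at hv hzero
    by_cases c1 : l + 1 ≤ 0 ∧ l + 1 ≤ n ∧ l + 1 < r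
    · obtain ⟨μ, -, h⟩ := exists_eq_mul (t := ⟨l + 1, r, n⟩) hX
        (by unfold Span.Valid; dsimp only; omega) hA (ν := Φ A) (by rw [hs]; simp [Span.comp])
      rcases hirr _ _ h.symm with h1 | h1 | rfl | rfl
      · exact absurd h1 hAne.1
      · exact absurd h1 hAne.2.1
      · left; rw [h, mul_one]
      · right; right; left; exact h
    by_cases c2 : 0 ≤ r - 1 ∧ n ≤ r - 1 ∧ l < r - 1
    · obtain ⟨μ, -, h⟩ := exists_eq_mul (t := ⟨l, r - 1, n⟩) hX
        (by unfold Span.Valid; dsimp only; omega) hB (ν := Φ A) (by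
          rw [hs]; simp [Span.comp]; omega)
      rcases hirr _ _ h.symm with h1 | h1 | rfl | rfl
      · exact absurd h1 hAne.2.2.1
      · exact absurd h1 hAne.2.2.2
      · right; left; rw [h, mul_one]
      · right; right; right; exact h
    · exfalso
      apply hne
      apply endSpan_injective hX
      rw [endSpan_mul hX, endSpan_mul hX, hs, hU]
      rcases lt_or_gt_of_ne hzero with hn | hn
      · obtain ⟨rfl, rfl⟩ : l = n ∧ r = 0 := by omega
        simp [Span.comp]
      · obtain ⟨rfl, rfl⟩ : l = 0 ∧ r = n := by omega
        simp [Span.comp, hn.le]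
        omega
  rcases key with h | h | h | h
  · exact Or.inl h
  · exact Or.inr h
  · exfalso
    rw [h] at hcomm
    have := congrArg (endSpan x₀) hcomm
    simp only [endSpan_mul hX, hA, hU] at this
    simp [Span.comp] at this
  · exfalso
    rw [h] at hcomm
    have := congrArg (endSpan x₀) hcomm
    simp only [endSpan_mul hX, hB, hU] at this
    simp [Span.comp] at this

/-- An automorphism that fixes the left shift is trivial. -/
theorem map_eq_self_of_shift (hX : ∀ x : X, x = x₀)
    (Φ : End (FreeInverseSemigroup X) ≃* End (FreeInverseSemigroup X))
    {A : End (FreeInverseSemigroup X)} (hA : endSpan x₀ A = ⟨-1, 1, 1⟩) (ΦA : Φ A = A)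
    (ν : End (FreeInverseSemigroup X)) : Φ ν = ν := by
  obtain ⟨U, hU⟩ := exists_endSpan hX (t := ⟨-1, 0, -1⟩) (by simp [Span.Valid])
  obtain ⟨B, hB⟩ := exists_endSpan hX (t := ⟨0, 2, 1⟩) (by simp [Span.Valid])
  obtain ⟨P, hP⟩ := exists_endSpan hX (t := ⟨0, 1, 0⟩) (by simp [Span.Valid])
  obtain ⟨Q, hQ⟩ := exists_endSpan hX (t := ⟨-1, 0, 0⟩) (by simp [Span.Valid])
  have ΦU := map_reflection hX Φ hU
  have hBA : B = U * A * U := endSpan_injective hX (by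
    simp only [endSpan_mul hX, hA, hB, hU]; simp [Span.comp])
  have ΦB : Φ B = B := by rw [hBA, map_mul, map_mul, ΦU, ΦA]
  have hQP : Q = U * P := endSpan_injective hX (by
    simp only [endSpan_mul hX, hP, hQ, hU]; simp [Span.comp])
  have hPQ : P = U * Q := endSpan_injective hX (by
    simp only [endSpan_mul hX, hP, hQ, hU]; simp [Span.comp])
  have hAP : A * P = B * Q := endSpan_injective hX (by
    simp only [endSpan_mul hX, hA, hP, hB, hQ]; simp [Span.comp])
  have hPU : P * U = P := endSpan_injective hX (by
    simp only [endSpan_mul hX, hP, hU]; simp [Span.comp])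
  -- PU = P forces root zero. A shift on the left lengthens every interval by one, so P is not left
  -- divisible by A or B, and neither is Φ P; its interval thus has length one.
  have hΦP : Φ P = P ∨ Φ P = Q := by
    have h0 := congrArg (fun ν => endSpan x₀ (Φ ν)) hPU
    simp only [map_mul, ΦU, endSpan_mul hX, hU] at h0
    have hv := valid_endSpan (x₀ := x₀) (Φ P)
    rcases hs : endSpan x₀ (Φ P) with ⟨l, r, n⟩
    rw [hs] at h0 hv
    have hn : n = 0 := by
      have := congrArg Span.root h0
      have h1 : (Span.comp ⟨l, r, n⟩ ⟨-1, 0, -1⟩).root = n * -1 := by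
        unfold Span.comp; split_ifs <;> rfl
      rw [h1] at this
      dsimp only at this
      omega
    subst hn
    unfold Span.Valid at hv
    dsimp only at hv
    have hno : ∀ C : End (FreeInverseSemigroup X), C = A ∨ C = B → Φ C = C → ∀ μ, Φ P ≠ C * μ := by
      intro C hC ΦC μ h
      have h1 : P = C * Φ.symm μ := by
        apply Φ.injective
        rw [h, map_mul, ΦC, MulEquiv.apply_symm_apply]
      have h2 := congrArg (endSpan x₀) h1
      have v := valid_endSpan (x₀ := x₀) (Φ.symm μ)
      rw [endSpan_mul hX, hP] at h2
      generalize endSpan x₀ (Φ.symm μ) = t at h2 v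
      unfold Span.Valid at v
      rcases hC with rfl | rfl
      · rw [hA] at h2
        simp [Span.comp] at h2
        omega
      · rw [hB] at h2
        simp [Span.comp] at h2
        omega
    by_cases c1 : l + 1 ≤ 0 ∧ l + 1 < r
    · obtain ⟨μ, -, h⟩ := exists_eq_mul (t := ⟨l + 1, r, 0⟩) hX
        (by unfold Span.Valid; dsimp only; omega) hA (ν := Φ P) (by rw [hs]; simp [Span.comp])
      exact absurd h (hno A (Or.inl rfl) ΦA μ)
    by_cases c2 : 0 ≤ r - 1 ∧ l < r - 1
    · obtain ⟨μ, -, h⟩ := exists_eq_mul (t := ⟨l, r - 1, 0⟩) hX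
        (by unfold Span.Valid; dsimp only; omega) hB (ν := Φ P) (by
          rw [hs]; simp [Span.comp]; omega)
      exact absurd h (hno B (Or.inr rfl) ΦB μ)
    rw [← (endSpan_injective hX).eq_iff, ← (endSpan_injective hX).eq_iff, hP, hQ, hs,
      Span.mk.injEq, Span.mk.injEq]
    omega
  have ΦP : Φ P = P := by
    rcases hΦP with h | h
    · exact h
    -- Exchanging P and Q would turn AP = BQ into AQ = BP, which fails.
    · exfalso
      have h' : Φ Q = P := by rw [hQP, map_mul, ΦU, h, ← hPQ]
      have h1 := congrArg (fun ν => endSpan x₀ (Φ ν)) hAP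
      simp only [map_mul, ΦA, ΦB, h, h', endSpan_mul hX, hA, hP, hB, hQ] at h1
      simp [Span.comp] at h1
  have ΦQ : Φ Q = Q := by rw [hQP, map_mul, ΦU, ΦP]
  -- Each endomorphism of root zero is a product of shifts followed on the right by P or Q, all of
  -- them fixed.
  have hconst : ∀ (n : ℕ) (ν : End (FreeInverseSemigroup X)), (endSpan x₀ ν).root = 0 →
      ((endSpan x₀ ν).hi - (endSpan x₀ ν).lo).toNat ≤ n → Φ ν = ν := by
    intro n
    induction n with
    | zero =>
      intro ν _ hn
      have := valid_endSpan (x₀ := x₀) ν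
      unfold Span.Valid at this
      omega
    | succ n ih =>
      intro ν h0 hn
      have hv := valid_endSpan (x₀ := x₀) ν
      rcases hs : endSpan x₀ ν with ⟨l, r, k⟩
      rw [hs] at h0 hv hn
      unfold Span.Valid at hv
      dsimp only at hv h0 hn
      subst h0
      by_cases c1 : l + 1 ≤ 0 ∧ l + 1 < r
      · obtain ⟨μ, hμ, h⟩ := exists_eq_mul (t := ⟨l + 1, r, 0⟩) hX
          (by unfold Span.Valid; dsimp only; omega) hA (ν := ν) (by rw [hs]; simp [Span.comp])
        rw [h, map_mul, ΦA, ih μ (by rw [hμ]) (by rw [hμ]; dsimp only; omega)]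
      by_cases c2 : 0 ≤ r - 1 ∧ l < r - 1
      · obtain ⟨μ, hμ, h⟩ := exists_eq_mul (t := ⟨l, r - 1, 0⟩) hX
          (by unfold Span.Valid; dsimp only; omega) hB (ν := ν) (by
            rw [hs]; simp [Span.comp]; omega)
        rw [h, map_mul, ΦB, ih μ (by rw [hμ]) (by rw [hμ]; dsimp only; omega)]
      have h1 : l = 0 ∧ r = 1 ∨ l = -1 ∧ r = 0 := by omega
      rcases h1 with ⟨rfl, rfl⟩ | ⟨rfl, rfl⟩
      · obtain rfl := endSpan_injective hX (hs.trans hP.symm)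
        exact ΦP
      · obtain rfl := endSpan_injective hX (hs.trans hQ.symm)
        exact ΦQ
  have hroot : ∀ a b : Span, (a.comp b).root = a.root * b.root := by
    intro a b; unfold Span.comp; split_ifs <;> rfl
  -- νP records the interval of ν(x₀), and νQ the same interval shifted by minus the root; together
  -- they determine ν.
  have k1 : Φ ν * P = ν * P := by
    conv_lhs => rw [← ΦP]
    rw [← map_mul]
    exact hconst _ _ (by rw [endSpan_mul hX, hroot, hP, mul_zero]) le_rfl
  have k2 : Φ ν * Q = ν * Q := by
    conv_lhs => rw [← ΦQ]
    rw [← map_mul]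
    exact hconst _ _ (by rw [endSpan_mul hX, hroot, hQ, mul_zero]) le_rfl
  have k1' := congrArg (endSpan x₀) k1
  have k2' := congrArg (endSpan x₀) k2
  simp only [endSpan_mul hX, hP, hQ] at k1' k2'
  apply endSpan_injective hX
  generalize endSpan x₀ (Φ ν) = s at *
  generalize endSpan x₀ ν = t at *
  have f1 : ∀ a : Span, a.comp ⟨0, 1, 0⟩ = ⟨a.lo, a.hi, 0⟩ := by
    intro a; unfold Span.comp; split_ifs <;> simp
  have f2 : ∀ a : Span, a.comp ⟨-1, 0, 0⟩ = ⟨a.lo - a.root, a.hi - a.root, 0⟩ := by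
    intro a; unfold Span.comp; split_ifs <;> simp <;> omega
  rw [f1, f1, Span.mk.injEq] at k1'
  rw [f2, f2, Span.mk.injEq] at k2'
  apply Span.ext <;> omega

theorem isInner_of_unique (hX : ∀ x : X, x = x₀)
    (Φ : End (FreeInverseSemigroup X) ≃* End (FreeInverseSemigroup X)) :
    IsInner Φ := by
  obtain ⟨U, hU⟩ := exists_endSpan hX (t := ⟨-1, 0, -1⟩) (by simp [Span.Valid])
  obtain ⟨A, hA⟩ := exists_endSpan hX (t := ⟨-1, 1, 1⟩) (by simp [Span.Valid])
  obtain ⟨B, hB⟩ := exists_endSpan hX (t := ⟨0, 2, 1⟩) (by simp [Span.Valid])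
  have hUU : U * U = 1 := endSpan_injective hX (by
    rw [endSpan_mul hX, hU, endSpan_one]; rfl)
  rcases map_shift hX Φ hA hB hU with h | h
  · exact isInner_of_conj 1 1 (mul_one _) (mul_one _) fun ν => by
      rw [map_eq_self_of_shift hX Φ hA h, one_mul, mul_one]
  · refine isInner_of_conj_eq Φ U U hUU hUU (map_eq_self_of_shift hX _ hA ?_)
    rw [conj_apply, h]
    apply endSpan_injective hX
    simp only [endSpan_mul hX, hA, hB, hU]
    simp [Span.comp]

end OneGenerator

/-! ### The empty case and the conclusion. -/

theorem isInner_of_isEmpty {X : Type u} [IsEmpty X]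
    (Φ : End (FreeInverseSemigroup X) ≃* End (FreeInverseSemigroup X)) : IsInner Φ :=
  isInner_of_conj 1 1 (mul_one _) (mul_one _) fun _ => hom_ext_of fun x => isEmptyElim x

end FreeInverseSemigroup

theorem mainTheorem9 (X : Type*) [Finite X]
    (Φ : InverseSemigroup.End (FreeInverseSemigroup X) ≃*
      InverseSemigroup.End (FreeInverseSemigroup X)) :
    InverseSemigroup.IsInner Φ := by
  rcases isEmpty_or_nonempty X with h | ⟨⟨x⟩⟩
  · exact FreeInverseSemigroup.isInner_of_isEmpty Φ
  · by_cases hX : ∀ y, y = x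
    · exact FreeInverseSemigroup.isInner_of_unique hX Φ
    · obtain ⟨y, hy⟩ := not_forall.1 hX
      exact FreeInverseSemigroup.isInner_of_ne Φ hy
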